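/- Let $E$ be a set and let $\lambda:2^E\to\mathbb{N}\cup\{\infty\}$ satisfy $\lambda(A)=\lambda(E\setminus A)$ and $\lambda(A)+\lambda(B)\ge\lambda(A\cup B)+\lambda(A\cap B)$ for all $A,B\subseteq E$. Suppose $\lambda$ is limit-closed: for every $n\in\mathbb{N}$, the union of a non-empty chain of sets $A$ with $\lambda(A)\le n$ is again a set with $\lambda\le n$. Let $k\ge 1$ be an integer. *Profiles.* For $l\in\mathbb{N}$ let $S_l=\{A\subseteq E:\lambda(A)<l\}$. A *$k$-profile* is a set $P\subseteq S_k$ that contains exactly one of $A$ and $E\setminus A$ for every $A\in S_k$, that is consistent (if $A\subsetneq B$, $E\setminus A\in P$ and $B\in P$, then $B=E\setminus A$), and that satisfies $E\setminus(A\cup B)\notin P$ for all $A,B\in P$. Its truncation to a $(k-1)$-profile is $P\cap S_{k-1}$. A set $A$ *distinguishes* two profiles if one of them contains $A$ and the other contains $E\setminus A$. *Pseudoflowers.* A set $J$ of elements of a cyclically ordered set $I$ is an *interval* if for all $x,y\in J$ at least one of the open arcs $]x,y[$ and $]y,x[$ is contained in $J$ (so the ends of an interval may be cuts of $I$); it is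 *non-trivial* if $\emptyset\ne J\ne I$. A *$k$-pseudoflower* is a partition $\Phi=(P_i)_{i\in I}$ of $E$ into non-empty sets, the *petals*, with a cyclically ordered index set $I$, such that $\lambda(\bigcup_{i\in J}P_i)\le k-1$ for every interval $J$ of $I$. The sets $\bigcup_{i\in J}P_i$ with $J$ a non-trivial interval are *displayed* by $\Phi$. A $k$-pseudoflower $\Phi=(Q_j)_{j\in I'}$ is a *concatenation* of a $k$-pseudoflower $\Psi=(P_i)_{i\in I}$, written $\Phi\le\Psi$, if there is a map $f:I\to I'$ such that $P_i\subseteq Q_{f(i)}$ for all $i\in I$ and such that $f^{-1}(J)$ is an interval of $I$ for every interval $J$ of $I'$. A $k$-pseudoflower is a *$k$-daisy* if it has at least four petals, every set displayed by it has $\lambda$-value exactly $k-1$, and in each of its concatenations $(Q_j)_{j\in I'}$ with finitely many petals, for every $J$ with $\emptyset\ne J\subsetneq I'$, we have $\lambda(\bigcup_{j\in J}Q_j)=k-1$ if and only if $J$ is an interval of $I'$. *Comparison by profiles.* Let $\mathcal{P}$ be a set of $k$-profiles that all have the same truncation to a $(k-1)$-profile. For $k$-pseudoflowers $\Phi$ and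 $\Psi$ let $\Phi\preccurlyeq\Psi$ if any two elements of $\mathcal{P}$ that are distinguished by the union of the petals of an interval of $\Phi$ are also distinguished by the union of the petals of an interval of $\Psi$. An element $\Phi$ is maximal in a pre-order if every element above $\Phi$ is also below $\Phi$. **Statement.** Let $\Phi$ be a $\le$-maximal $k$-pseudoflower which has a concatenation that is a $k$-daisy, and suppose that there are at least three elements of $\mathcal{P}$ that are pairwise distinguished by sets displayed by $\Phi$. Then $\Phi$ is $\preccurlyeq$-maximal: for every $k$-pseudoflower $\Psi$ with $\Phi\preccurlyeq\Psi$ also $\Psi\preccurlyeq\Phi$. -/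

import Mathlib

universe u

/-- A set of elements of a cyclically ordered type is an interval if any two of its elements are
joined by one of the two open arcs between them inside the set. This covers `∅`, the whole type,
singletons, and intervals whose ends are cuts rather than elements. -/
def IsCyclicInterval {I : Type u} [CircularOrder I] (J : Set I) : Prop :=
  ∀ x ∈ J, ∀ y ∈ J, Set.cIoo x y ⊆ J ∨ Set.cIoo y x ⊆ J

/-- A limit-closed connectivity system on the ground set `E`. -/
structure ConnectivitySystem (E : Type u) where
  conn : Set E → ℕ∞
  conn_compl : ∀ A : Set E, conn Aᶜ = conn A
  submodular : ∀ A B : Set E, conn (A ∪ B) + conn (A ∩ B) ≤ conn A + conn B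
  limitClosed : ∀ (n : ℕ) (C : Set (Set E)), C.Nonempty → IsChain (· ⊆ ·) C →
    (∀ A ∈ C, conn A ≤ n) → conn (⋃₀ C) ≤ n

namespace ConnectivitySystem

variable {E : Type u}

/-- A `k`-profile: a consistent orientation, with the profile property, of the system of all
sets of connectivity less than `k`. The inverse of a set is its complement, and the join of two
sets is their union. -/
structure IsProfile (M : ConnectivitySystem E) (k : ℕ) (P : Set (Set E)) : Prop where
  conn_lt : ∀ A ∈ P, M.conn A < k
  orientation : ∀ A : Set E, M.conn A < k → ∃! B : Set E, B ∈ P ∧ (B = A ∨ B = Aᶜ)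
  consistent : ∀ A B : Set E, Aᶜ ∈ P → B ∈ P → A ⊂ B → B = Aᶜ
  profile : ∀ A ∈ P, ∀ B ∈ P, (A ∪ B)ᶜ ∉ P

/-- The truncation of a profile to an `l`-profile. -/
def truncation (M : ConnectivitySystem E) (l : ℕ) (P : Set (Set E)) : Set (Set E) :=
  {A ∈ P | M.conn A < l}

/-- A `k`-pseudoflower: a partition of `E` into nonempty petals with a cyclically ordered index
type such that the union of every interval of petals has connectivity at most `k - 1`. As the
petals are nonempty and disjoint, the index type embeds into `E`, so that it is no restriction to
take it from the universe of `E`. -/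
structure PseudoFlower (M : ConnectivitySystem E) (k : ℕ) where
  Index : Type u
  [order : CircularOrder Index]
  petal : Index → Set E
  petal_nonempty : ∀ i, (petal i).Nonempty
  petal_disjoint : ∀ i j, i ≠ j → Disjoint (petal i) (petal j)
  petal_cover : ⋃ i, petal i = Set.univ
  conn_lt : ∀ J : Set Index, IsCyclicInterval J → M.conn (⋃ i ∈ J, petal i) < k

attribute [instance] PseudoFlower.order

namespace PseudoFlower

variable {M : ConnectivitySystem E} {k : ℕ}

/-- The union of the petals with index in `J`. -/
def unionOf (Φ : M.PseudoFlower k) (J : Set Φ.Index) : Set E :=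
  ⋃ i ∈ J, Φ.petal i

/-- `A` is displayed by `Φ`: it is the union of a non-trivial interval of petals. -/
def Displays (Φ : M.PseudoFlower k) (A : Set E) : Prop :=
  ∃ J : Set Φ.Index, IsCyclicInterval J ∧ J.Nonempty ∧ J ≠ Set.univ ∧ Φ.unionOf J = A

/-- `Φ` is a concatenation of `Ψ` (and `Ψ` is an extension of `Φ`). -/
def IsConcatenation (Φ Ψ : M.PseudoFlower k) : Prop :=
  ∃ f : Ψ.Index → Φ.Index, (∀ i, Ψ.petal i ⊆ Φ.petal (f i)) ∧
    ∀ J : Set Φ.Index, IsCyclicInterval J → IsCyclicInterval (f ⁻¹' J)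

/-- `Φ ≤ Ψ` if and only if `Φ` is a concatenation of `Ψ`. -/
instance : Preorder (M.PseudoFlower k) where
  le := IsConcatenation
  le_refl Φ := ⟨id, fun _ => subset_rfl, fun _ h => h⟩
  le_trans := by
    rintro Φ Ψ Θ ⟨f, hf, hf'⟩ ⟨g, hg, hg'⟩
    exact ⟨f ∘ g, fun i => (hg i).trans (hf (g i)), fun J hJ => hg' _ (hf' J hJ)⟩

/-- A `k`-flower: at least four petals, and the union of every non-trivial interval of petals has
connectivity exactly `k - 1`. -/
def IsFlower (Φ : M.PseudoFlower k) : Prop :=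
  4 ≤ ENat.card Φ.Index ∧ ∀ A : Set E, Φ.Displays A → M.conn A + 1 = k

/-- A `k`-daisy: a `k`-flower such that in every finite concatenation the non-trivial unions of
petals of connectivity `k - 1` are exactly those whose indices form an interval. -/
def IsDaisy (Φ : M.PseudoFlower k) : Prop :=
  Φ.IsFlower ∧ ∀ Ψ : M.PseudoFlower k, Ψ ≤ Φ → Finite Ψ.Index →
    ∀ J : Set Ψ.Index, J.Nonempty → J ≠ Set.univ →
      (M.conn (Ψ.unionOf J) + 1 = k ↔ IsCyclicInterval J)

end PseudoFlower

/-- The set `A` distinguishes the profiles `P` and `Q`: they contain distinct orientations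
of `A`. -/
def Distinguishes (A : Set E) (P Q : Set (Set E)) : Prop :=
  (A ∈ P ∧ Aᶜ ∈ Q) ∨ (Aᶜ ∈ P ∧ A ∈ Q)

namespace PseudoFlower

variable {M : ConnectivitySystem E} {k : ℕ}

/-- Some set displayed by `Φ` distinguishes `P` and `Q`. -/
def DisplaysDistinction (Φ : M.PseudoFlower k) (P Q : Set (Set E)) : Prop :=
  ∃ A : Set E, Φ.Displays A ∧ Distinguishes A P Q

/-- At least three elements of `Pset` are pairwise distinguished by sets displayed by `Φ`. -/
def DistinguishesThree (Φ : M.PseudoFlower k) (Pset : Set (Set (Set E))) : Prop :=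
  ∃ P ∈ Pset, ∃ Q ∈ Pset, ∃ R ∈ Pset,
    Φ.DisplaysDistinction P Q ∧ Φ.DisplaysDistinction P R ∧ Φ.DisplaysDistinction Q R

/-- The pre-order `Φ ≼ Ψ` with respect to `Pset`: any two elements of `Pset` that are distinguished by
the union of an interval of `Φ` are distinguished by the union of an interval of `Ψ`. -/
def Prec (Pset : Set (Set (Set E))) (Φ Ψ : M.PseudoFlower k) : Prop :=
  ∀ P ∈ Pset, ∀ Q ∈ Pset,
    (∃ J : Set Φ.Index, IsCyclicInterval J ∧ Distinguishes (Φ.unionOf J) P Q) →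
    ∃ J : Set Ψ.Index, IsCyclicInterval J ∧ Distinguishes (Ψ.unionOf J) P Q

/-- Maximality in the pre-order `≼` among all `k`-pseudoflowers. -/
def IsPrecMaximal (Pset : Set (Set (Set E))) (Φ : M.PseudoFlower k) : Prop :=
  ∀ Ψ : M.PseudoFlower k, Prec Pset Φ Ψ → Prec Pset Ψ Φ

end PseudoFlower

end ConnectivitySystem

/-! Say that a profile lives in `A` if it contains `Aᶜ`. Suppose an interval of `Ψ` distinguishes
`P` and `Q` but none of `Φ` does. Not being distinguished by `Φ` is transitive, so two of the three
given profiles, `q` and `r`, are such that `Φ` distinguishes every two of `P`, `q`, `r`. As `Φ ≼ Ψ`,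
intervals of `Ψ` distinguish both pairs `P`, `Q` and `q`, `r`. Profiles have linearly ordered
positions in a cut-open `Ψ`, and this yields one set `Y` distinguishing both pairs
(`PseudoFlower.exists_common_separation`). From here on only `Y` is remembered of `Ψ`.

If `P` lives in a petal of `Φ`, so does `Q`, while `q` and `r` do not. Uncrossing `Y` with intervals
of `Φ` shows that `Y` cuts this petal into two petals of a larger pseudoflower, against
`≤`-maximality (`first_petal_split`, `not_isMax_of_split`).

Otherwise `P` and `Q` live at a cut, which becomes the end of a linear order without maximum
(`exists_linearizes_end`). Limit-closedness provides arcs near the end that `Y` splits into parts of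
connectivity at least `m = k - 1`. Uncrossing then bounds by `m` the connectivity of such an arc
together with a final segment that is not adjacent to it (`conn_skip_le`), and this spreads to
opposite arcs of `Φ` (`conn_opposite_le`). In a daisy the union of opposite arcs has connectivity
greater than `m` (`IsDaisy.exists_four_arcs`), a contradiction. -/

/-! ### Cutting a cyclic order open into a linear order -/

/-- A linear order on a cyclically ordered type arises by cutting if the cyclic intervals are the
order-connected sets and their complements. -/
def Linearizes {I : Type u} [CircularOrder I] (r : LinearOrder I) : Prop :=
  ∀ J : Set I, IsCyclicInterval J ↔ J.OrdConnected ∨ Jᶜ.OrdConnected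

/-- The linear order `r` induces the given cyclic order. -/
def InducesCircular {I : Type u} [CircularOrder I] (r : LinearOrder I) : Prop :=
  ∀ x y z : I, sbtw x y z ↔ (x < y ∧ y < z) ∨ (y < z ∧ z < x) ∨ (z < x ∧ x < y)

theorem InducesCircular.linearizes {I : Type u} [CircularOrder I] {r : LinearOrder I}
    (hr : InducesCircular r) : Linearizes r := by
  have mem_arc : ∀ x y z : I, y ∈ Set.cIoo x z ↔
      (x < y ∧ y < z) ∨ (y < z ∧ z < x) ∨ (z < x ∧ x < y) := fun x y z => hr x y z
  have main : ∀ J : Set I, J.OrdConnected → ∀ x ∈ J, ∀ y ∈ J, x ≤ y → Set.cIoo x y ⊆ J := by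
    intro J hJ x hx y hy hxy z hz
    rw [mem_arc] at hz
    rcases hz with h | h | h
    · exact hJ.out hx hy ⟨h.1.le, h.2.le⟩
    · exact absurd hxy h.2.not_ge
    · exact absurd hxy h.1.not_ge
  have main' : ∀ J : Set I, Jᶜ.OrdConnected → ∀ x ∈ J, ∀ y ∈ J, x ≤ y →
      Set.cIoo x y ⊆ J ∨ Set.cIoo y x ⊆ J := by
    intro J hJ x hx y hy hxy
    by_contra hcon
    simp only [not_or, Set.not_subset, mem_arc] at hcon
    obtain ⟨⟨a, ha, haJ⟩, b, hb, hbJ⟩ := hcon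
    have ha' : x < a ∧ a < y := by
      rcases ha with h | h | h
      · exact h
      · exact absurd hxy h.2.not_ge
      · exact absurd hxy h.1.not_ge
    rcases hb with h | h | h
    · exact absurd hxy (h.1.trans h.2).not_ge
    · exact hJ.out hbJ haJ ⟨h.1.le, ha'.1.le⟩ hx
    · exact hJ.out haJ hbJ ⟨ha'.2.le, h.2.le⟩ hy
  intro J
  constructor
  · intro hJ
    by_contra hcon
    simp only [not_or, Set.ordConnected_iff, not_forall, Set.not_subset] at hcon
    obtain ⟨⟨x, hx, z, hz, -, y, hy, hyJ⟩, x', hx', z', hz', -, y', hy', hyJ'⟩ := hcon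
    rw [Set.mem_compl_iff, not_not] at hyJ'
    have ne : ∀ a b : I, a ∈ J → b ∉ J → a ≠ b := fun a b ha hb h => hb (h ▸ ha)
    have hxy : x < y := lt_of_le_of_ne hy.1 (ne _ _ hx hyJ)
    have hyz : y < z := lt_of_le_of_ne hy.2 (ne _ _ hz hyJ).symm
    have hxy' : x' < y' := lt_of_le_of_ne hy'.1 (ne _ _ hyJ' hx').symm
    have hyz' : y' < z' := lt_of_le_of_ne hy'.2 (ne _ _ hyJ' hz')
    -- The inner arc from `x` to `z` contains `y ∉ J`, so the outer one lies in `J`. This forces `x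
    -- < x' < y' < z' < z`, and then `x'` and `z'` block the two arcs between `x` and `y'`.
    have hout : ∀ w, w < x ∨ z < w → w ∈ J := by
      intro w hw
      rcases hJ x hx z hz with h | h
      · exact absurd (h ((mem_arc _ _ _).2 (Or.inl ⟨hxy, hyz⟩))) hyJ
      · refine h ((mem_arc _ _ _).2 ?_)
        rcases hw with hw | hw
        · exact Or.inr (Or.inl ⟨hw, hxy.trans hyz⟩)
        · exact Or.inr (Or.inr ⟨hxy.trans hyz, hw⟩)
    have h1 : x < x' := lt_of_le_of_ne (not_lt.1 fun h => hx' (hout _ (Or.inl h))) (ne _ _ hx hx')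
    have h2 : z' < z :=
      lt_of_le_of_ne (not_lt.1 fun h => hz' (hout _ (Or.inr h))) (ne _ _ hz hz').symm
    rcases hJ x hx y' hyJ' with h | h
    · exact hx' (h ((mem_arc _ _ _).2 (Or.inl ⟨h1, hxy'⟩)))
    · exact hz' (h ((mem_arc _ _ _).2 (Or.inr (Or.inr ⟨h1.trans hxy', hyz'⟩))))
  · rintro (hJ | hJ) x hx y hy
    · rcases le_total x y with h | h
      · exact Or.inl (main J hJ x hx y hy h)
      · exact Or.inr (main J hJ y hy x hx h)
    · rcases le_total x y with h | h
      · exact main' J hJ x hx y hy h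
      · exact (main' J hJ y hy x hx h).symm

theorem sbtw_trichotomy {I : Type u} [CircularOrder I] (x y z : I) :
    sbtw x y z ∨ sbtw z y x ∨ x = y ∨ y = z ∨ z = x := by
  by_cases h1 : btw x y z
  · by_cases h2 : btw z y x
    · exact Or.inr (Or.inr (h1.antisymm h2))
    · exact Or.inl (h1.sbtw_of_not_btw h2)
  · exact Or.inr (Or.inl (sbtw_iff_not_btw.2 h1))

/-- Increasing triples suffice: their rotations follow by cyclicity, and any other triple of
distinct elements is a rotated increasing triple read backwards, which asymmetry of `sbtw` excludes.
-/
theorem inducesCircular_of_lt_lt {I : Type u} [CircularOrder I] {r : LinearOrder I}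
    (h : ∀ x y z : I, x < y → y < z → sbtw x y z) : InducesCircular r := by
  have main : ∀ x y z : I, (x < y ∧ y < z) ∨ (y < z ∧ z < x) ∨ (z < x ∧ x < y) → sbtw x y z := by
    rintro x y z (⟨h1, h2⟩ | ⟨h1, h2⟩ | ⟨h1, h2⟩)
    · exact h _ _ _ h1 h2
    · exact (h _ _ _ h1 h2).cyclic_right
    · exact (h _ _ _ h1 h2).cyclic_left
  refine fun x y z => ⟨fun hs => ?_, main x y z⟩
  have hxy : x ≠ y := by rintro rfl; exact sbtw_irrefl_left hs
  have hyz : y ≠ z := by rintro rfl; exact sbtw_irrefl_right hs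
  have hzx : z ≠ x := by rintro rfl; exact sbtw_irrefl_left_right hs
  have hn := fun h' => hs.not_sbtw (main z y x h')
  rcases lt_or_gt_of_ne hxy with h1 | h1 <;> rcases lt_or_gt_of_ne hyz with h2 | h2 <;>
    rcases lt_or_gt_of_ne hzx with h3 | h3 <;> simp_all

/-- A cyclic order can be cut open immediately before any of its elements. -/
theorem exists_inducesCircular {I : Type u} [CircularOrder I] (i₀ : I) :
    ∃ r : LinearOrder I, InducesCircular r ∧ ∀ x, r.le i₀ x := by
  classical
  let lt : I → I → Prop := fun x y => sbtw i₀ x y ∨ (x = i₀ ∧ y ≠ i₀)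
  have sto : IsStrictTotalOrder I lt :=
    { irrefl := by
        rintro x (h | h)
        · exact sbtw_irrefl_right h
        · exact h.2 h.1
      trans := by
        rintro x y z (h | ⟨rfl, h⟩) (h' | ⟨rfl, h'⟩)
        · exact Or.inl (h.trans_right h')
        · exact absurd h sbtw_irrefl_left_right
        · exact Or.inr ⟨rfl, fun hz => sbtw_irrefl_left_right (hz ▸ h')⟩
        · exact absurd rfl h
      trichotomous := by
        intro x y h1 h2
        simp only [lt, not_or, not_and, not_not] at h1 h2
        rcases sbtw_trichotomy i₀ x y with h | h | h | h | h
        · exact absurd h h1.1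
        · exact absurd h.cyclic_right h2.1
        · exact h.symm.trans (h1.2 h.symm).symm
        · exact h
        · exact (h2.2 h).trans h.symm }
  refine ⟨linearOrderOfSTO lt, inducesCircular_of_lt_lt ?_, ?_⟩
  · rintro x y z (h | ⟨rfl, h⟩) (h' | ⟨rfl, h'⟩)
    · exact (h'.cyclic_right.trans_left h).cyclic_left
    · exact absurd h sbtw_irrefl_left_right
    · exact h'
    · exact absurd rfl h
  · intro x
    by_cases hx : x = i₀
    · exact Or.inl hx.symm
    · exact Or.inr (Or.inr ⟨rfl, hx⟩)

/-- The linear order obtained by moving a lower set to the end. -/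
@[reducible]
noncomputable def LinearOrder.rotate {I : Type u} (r : LinearOrder I) (U : Set I) :
    LinearOrder I :=
  open scoped Classical in
  LinearOrder.lift' (fun i => toLex (decide (i ∈ U), i) : I → Bool ×ₗ I) (fun i j h => by
    simpa using congrArg (fun p => (ofLex p).2) h)

theorem LinearOrder.rotate_lt {I : Type u} (r : LinearOrder I) (U : Set I) (x y : I) :
    (r.rotate U).lt x y ↔ (x ∉ U ∧ y ∈ U) ∨ ((x ∈ U ↔ y ∈ U) ∧ r.lt x y) := by
  classical
  change (toLex (decide (x ∈ U), x) : Bool ×ₗ I) < toLex (decide (y ∈ U), y) ↔ _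
  rw [Prod.Lex.toLex_lt_toLex]
  by_cases hx : x ∈ U <;> by_cases hy : y ∈ U <;> simp [hx, hy]

theorem InducesCircular.rotate {I : Type u} [CircularOrder I] {r : LinearOrder I}
    (hr : InducesCircular r) {U : Set I} (hU : IsLowerSet U) : InducesCircular (r.rotate U) := by
  apply inducesCircular_of_lt_lt
  intro x y z hxy hyz
  rw [r.rotate_lt] at hxy hyz
  have key : ∀ a b, a ∈ U → b ∉ U → r.lt a b := fun a b ha hb =>
    lt_of_not_ge fun h => hb (hU h ha)
  rw [hr]
  by_cases hx : x ∈ U <;> by_cases hy : y ∈ U <;> by_cases hz : z ∈ U <;>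
    simp_all

/-- The reversed linear order on the same type. -/
abbrev LinearOrder.reverse {I : Type u} (r : LinearOrder I) : LinearOrder I :=
  @OrderDual.instLinearOrder I r

/-- Order-connectedness does not see the direction of the order. `InducesCircular` would fail here,
since the reversed order induces the opposite cyclic order; hence the weaker notion `Linearizes`. -/
theorem Linearizes.reverse {I : Type u} [CircularOrder I] {r : LinearOrder I}
    (hr : Linearizes r) : Linearizes r.reverse := by
  have dual : ∀ J : Set I, @Set.OrdConnected I r.toPreorder J →
      @Set.OrdConnected I r.reverse.toPreorder J := fun J hJ =>
    @Set.OrdConnected.mk I r.reverse.toPreorder J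
      fun x hx y hy z hz => (@Set.OrdConnected.out I r.toPreorder J hJ) hy hx ⟨hz.2, hz.1⟩
  have dual' : ∀ J : Set I, @Set.OrdConnected I r.reverse.toPreorder J →
      @Set.OrdConnected I r.toPreorder J := fun J hJ =>
    @Set.OrdConnected.mk I r.toPreorder J
      fun x hx y hy z hz => (@Set.OrdConnected.out I r.reverse.toPreorder J hJ) hy hx ⟨hz.2, hz.1⟩
  intro J
  rw [hr J]
  exact or_congr ⟨dual J, dual' J⟩ ⟨dual Jᶜ, dual' Jᶜ⟩

/-! ### Uncrossing, and profiles with a common truncation -/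

namespace ConnectivitySystem

variable {E : Type u} {M : ConnectivitySystem E} {m : ℕ}

/-- This and the next two lemmas are the forms in which submodularity is used: three of the four
terms are bounded by `m`, which is finite and cancels in `ℕ∞`. -/
theorem conn_union_le {A B : Set E} (hA : M.conn A ≤ m) (hB : M.conn B ≤ m)
    (h : m ≤ M.conn (A ∩ B)) : M.conn (A ∪ B) ≤ m := by
  have h1 : M.conn (A ∪ B) + m ≤ m + m :=
    (add_le_add_right h _).trans ((M.submodular A B).trans (add_le_add hA hB))
  exact (ENat.add_le_add_iff_right (ENat.natCast_ne_top m)).1 h1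

theorem conn_inter_le {A B : Set E} (hA : M.conn A ≤ m) (hB : M.conn B ≤ m)
    (h : m ≤ M.conn (A ∪ B)) : M.conn (A ∩ B) ≤ m := by
  have h1 : m + M.conn (A ∩ B) ≤ m + m :=
    (add_le_add_left h _).trans ((M.submodular A B).trans (add_le_add hA hB))
  exact (ENat.add_le_add_iff_left (ENat.natCast_ne_top m)).1 h1

theorem le_conn_of_le_union {A B : Set E} (hA : m ≤ M.conn (A ∩ B)) (hB : M.conn B ≤ m)
    (h : m ≤ M.conn (A ∪ B)) : m ≤ M.conn A := by
  have h1 : (m : ℕ∞) + m ≤ M.conn A + m :=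
    (add_le_add h hA).trans ((M.submodular A B).trans (add_le_add_right hB _))
  exact (ENat.add_le_add_iff_right (ENat.natCast_ne_top m)).1 h1

theorem conn_lt_succ_iff {A : Set E} : M.conn A < (m + 1 : ℕ) ↔ M.conn A ≤ m := by
  rw [Nat.cast_add, Nat.cast_one, ENat.lt_add_one_iff (ENat.natCast_ne_top m)]

theorem conn_add_one_eq_iff {A : Set E} : M.conn A + 1 = (m + 1 : ℕ) ↔ M.conn A = m := by
  rw [Nat.cast_add, Nat.cast_one]
  simp only [le_antisymm_iff, ENat.add_le_add_iff_right ENat.one_ne_top]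

theorem conn_le_compl {A : Set E} (hA : M.conn A ≤ m) : M.conn Aᶜ ≤ m := by
  rwa [M.conn_compl]

/-- A family of profiles of order `m + 1` with a common truncation, none of which contains the
whole ground set. -/
structure IsProfileFamily (M : ConnectivitySystem E) (m : ℕ) (F : Set (Set (Set E))) : Prop where
  isProfile : ∀ P ∈ F, M.IsProfile (m + 1) P
  univ_notMem : ∀ P ∈ F, Set.univ ∉ P
  mem_of_mem : ∀ P ∈ F, ∀ Q ∈ F, ∀ A, M.conn A < m → A ∈ P → A ∈ Q

/-- `P` lives in `A` and `Q` lives in the complement of `A`. -/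
def Separates (A : Set E) (P Q : Set (Set E)) : Prop :=
  Aᶜ ∈ P ∧ A ∈ Q

theorem Separates.compl {A : Set E} {P Q : Set (Set E)} (h : Separates A P Q) :
    Separates Aᶜ Q P :=
  ⟨by rw [compl_compl]; exact h.2, h.1⟩

namespace IsProfileFamily

variable {F : Set (Set (Set E))} {P Q : Set (Set E)} {A B : Set E}

theorem conn_le (hF : M.IsProfileFamily m F) (hP : P ∈ F) (hA : A ∈ P) : M.conn A ≤ m :=
  conn_lt_succ_iff.1 ((hF.isProfile P hP).conn_lt A hA)

theorem mem_or_compl_mem (hF : M.IsProfileFamily m F) (hP : P ∈ F) (hA : M.conn A ≤ m) :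
    A ∈ P ∨ Aᶜ ∈ P := by
  obtain ⟨B, ⟨hB, rfl | rfl⟩, -⟩ := (hF.isProfile P hP).orientation A (conn_lt_succ_iff.2 hA)
  · exact Or.inl hB
  · exact Or.inr hB

/-- Uniqueness of the orientation leaves only the case `A = Aᶜ`, where `E` is empty and `A` is the
whole ground set. -/
theorem compl_notMem (hF : M.IsProfileFamily m F) (hP : P ∈ F) (hA : A ∈ P) : Aᶜ ∉ P := by
  intro hA'
  obtain ⟨B, -, hB⟩ := (hF.isProfile P hP).orientation A ((hF.isProfile P hP).conn_lt A hA)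
  have h : A = Aᶜ := (hB A ⟨hA, Or.inl rfl⟩).trans (hB Aᶜ ⟨hA', Or.inr rfl⟩).symm
  refine hF.univ_notMem P hP ?_
  have : A = Set.univ := Set.eq_univ_of_forall fun x => by
    by_contra hx
    exact hx (h ▸ (show x ∈ Aᶜ from hx))
  exact this ▸ hA

theorem compl_mem (hF : M.IsProfileFamily m F) (hP : P ∈ F) (hA : M.conn A ≤ m)
    (hA' : A ∉ P) : Aᶜ ∈ P :=
  (hF.mem_or_compl_mem hP hA).resolve_left hA'

/-- If `Aᶜ ∈ P`, consistency gives `B = Aᶜ`; then `A ⊆ Aᶜ`, so `A` is empty and `B` is the whole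
ground set, which is excluded. -/
theorem mem_of_subset (hF : M.IsProfileFamily m F) (hP : P ∈ F) (hB : B ∈ P) (hAB : A ⊆ B)
    (hA : M.conn A ≤ m) : A ∈ P := by
  by_contra hA'
  have hAc := hF.compl_mem hP hA hA'
  have hne : A ≠ B := fun h => hA' (h ▸ hB)
  have h := (hF.isProfile P hP).consistent A B hAc hB (hAB.ssubset_of_ne hne)
  subst h
  refine hF.univ_notMem P hP ?_
  have : Aᶜ = Set.univ := Set.eq_univ_of_forall fun x hx => hAB hx hx
  exact this ▸ hB

theorem union_mem (hF : M.IsProfileFamily m F) (hP : P ∈ F) (hA : A ∈ P) (hB : B ∈ P)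
    (h : M.conn (A ∪ B) ≤ m) : A ∪ B ∈ P :=
  (hF.mem_or_compl_mem hP h).resolve_right ((hF.isProfile P hP).profile A hA B hB)

theorem compl_mem_of_subset (hF : M.IsProfileFamily m F) (hP : P ∈ F) (hA : Aᶜ ∈ P) (hAB : A ⊆ B)
    (hB : M.conn B ≤ m) : Bᶜ ∈ P :=
  hF.mem_of_subset hP hA (Set.compl_subset_compl.2 hAB) (conn_le_compl hB)

theorem compl_inter_mem (hF : M.IsProfileFamily m F) (hP : P ∈ F) (hA : Aᶜ ∈ P) (hB : Bᶜ ∈ P)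
    (h : M.conn (A ∩ B) ≤ m) : (A ∩ B)ᶜ ∈ P := by
  rw [Set.compl_inter]
  exact hF.union_mem hP hA hB (by rw [← Set.compl_inter]; exact conn_le_compl h)

theorem mem_of_disjoint (hF : M.IsProfileFamily m F) (hP : P ∈ F) (hA : Aᶜ ∈ P)
    (h : Disjoint A B) (hB : M.conn B ≤ m) : B ∈ P :=
  hF.mem_of_subset hP hA h.subset_compl_left hB

/-- The common truncation makes the profiles agree on all sets of connectivity less than `m`. This
is the source of the lower bounds needed for uncrossing. -/
theorem le_conn (hF : M.IsProfileFamily m F) (hP : P ∈ F) (hQ : Q ∈ F) (h : Separates A P Q) :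
    m ≤ M.conn A := by
  by_contra hlt
  exact hF.compl_notMem hP (hF.mem_of_mem Q hQ P hP A (not_le.1 hlt) h.2) h.1

/-- If `A ∪ B` had connectivity less than `m`, it would separate `P` from `Q` as well, contradicting
`le_conn`. So uncrossing bounds `A ∩ B`. -/
theorem separates_inter (hF : M.IsProfileFamily m F) (hP : P ∈ F) (hQ : Q ∈ F)
    (hA : Separates A P Q) (hB : Separates B P Q) : Separates (A ∩ B) P Q := by
  have hA' := hF.conn_le hQ hA.2
  have hB' := hF.conn_le hQ hB.2
  have h : m ≤ M.conn (A ∪ B) := by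
    by_contra hlt
    have hle := (not_le.1 hlt).le
    exact hlt (hF.le_conn hP hQ
      ⟨hF.compl_mem_of_subset hP hA.1 Set.subset_union_left hle, hF.union_mem hQ hA.2 hB.2 hle⟩)
  have h' := conn_inter_le hA' hB' h
  exact ⟨hF.compl_inter_mem hP hA.1 hB.1 h', hF.mem_of_subset hQ hA.2 Set.inter_subset_left h'⟩

theorem separates_union (hF : M.IsProfileFamily m F) (hP : P ∈ F) (hQ : Q ∈ F)
    (hA : Separates A P Q) (hB : Separates B P Q) : Separates (A ∪ B) P Q := by
  have h := (hF.separates_inter hQ hP hA.compl hB.compl).compl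
  rwa [← Set.compl_union, compl_compl] at h

end IsProfileFamily

/-! ### Pseudoflowers as fibres of maps to an ordered index type -/

namespace PseudoFlower

variable {k : ℕ}

/-- Every element of the ground set lies in exactly one petal. -/
theorem exists_index (Φ : M.PseudoFlower k) :
    ∃ g : E → Φ.Index, Function.Surjective g ∧ ∀ J : Set Φ.Index, Φ.unionOf J = g ⁻¹' J := by
  have hcov : ∀ x : E, ∃ i, x ∈ Φ.petal i := fun x => by
    have : x ∈ ⋃ i, Φ.petal i := Φ.petal_cover ▸ Set.mem_univ x
    simpa using this
  choose g hg using hcov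
  have huniq : ∀ x i, x ∈ Φ.petal i → g x = i := fun x i hx => by
    by_contra hne
    exact Set.disjoint_left.1 (Φ.petal_disjoint _ _ hne) (hg x) hx
  refine ⟨g, fun i => ?_, fun J => ?_⟩
  · obtain ⟨x, hx⟩ := Φ.petal_nonempty i
    exact ⟨x, huniq x i hx⟩
  · ext x
    simp only [unionOf, Set.mem_iUnion, Set.mem_preimage]
    constructor
    · rintro ⟨i, hi, hx⟩
      rwa [huniq x i hx]
    · exact fun h => ⟨g x, h, hg x⟩

theorem petal_eq_unionOf (Φ : M.PseudoFlower k) (i : Φ.Index) : Φ.petal i = Φ.unionOf {i} := by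
  simp [unionOf]

/-- The pseudoflower whose petals are the fibres of a map to a linear order. -/
def ofLinearOrder {L : Type u} [LinearOrder L] (g : E → L) (hg : Function.Surjective g)
    (h : ∀ J : Set L, J.OrdConnected → M.conn (g ⁻¹' J) < k) : M.PseudoFlower k :=
  letI := LinearOrder.toCircularOrder L
  { Index := L
    petal := fun i => g ⁻¹' {i}
    petal_nonempty := fun i => hg i
    petal_disjoint := fun i j hij => Set.disjoint_left.2 fun x hi hj => hij (hi.symm.trans hj)
    petal_cover := by ext x; simp
    conn_lt := by
      intro J hJ
      have heq : (⋃ i ∈ J, g ⁻¹' {i}) = g ⁻¹' J := by ext x; simp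
      have hL : InducesCircular (I := L) inferInstance := fun _ _ _ => Iff.rfl
      rw [heq]
      rcases (hL.linearizes J).1 hJ with hJ | hJ
      · exact h J hJ
      · rw [← M.conn_compl]
        exact h Jᶜ hJ }

end PseudoFlower

theorem distinguishes_iff {A : Set E} {P Q : Set (Set E)} :
    Distinguishes A P Q ↔ Separates A P Q ∨ Separates A Q P := by
  unfold Distinguishes Separates
  tauto

theorem Distinguishes.symm {A : Set E} {P Q : Set (Set E)} (h : Distinguishes A P Q) :
    Distinguishes A Q P := by
  rw [distinguishes_iff] at *
  exact Or.symm h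

theorem Distinguishes.compl {A : Set E} {P Q : Set (Set E)} (h : Distinguishes A P Q) :
    Distinguishes Aᶜ P Q := by
  rw [distinguishes_iff] at *
  exact h.symm.imp Separates.compl Separates.compl

theorem Separates.distinguishes {A : Set E} {P Q : Set (Set E)} (h : Separates A P Q) :
    Distinguishes A P Q :=
  distinguishes_iff.2 (Or.inl h)

/-! ### One set that distinguishes two pairs of profiles -/

namespace IsProfileFamily

variable {F : Set (Set (Set E))} {P Q : Set (Set E)}

theorem mem_iff_of_not_distinguishes (hF : M.IsProfileFamily m F) (hP : P ∈ F) (hQ : Q ∈ F)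
    {A : Set E} (hA : M.conn A ≤ m) (h : ¬ Distinguishes A P Q) : A ∈ P ↔ A ∈ Q := by
  have h1 := hF.mem_or_compl_mem hP hA
  have h2 := hF.mem_or_compl_mem hQ hA
  have h3 := fun h => hF.compl_notMem hP (A := A) h
  have h4 := fun h => hF.compl_notMem hQ (A := A) h
  unfold Distinguishes at h
  tauto

variable {L : Type u} {r : LinearOrder L} {g : E → L}

/-- Profiles distinguished by an order-connected set are distinguished by a lower set. -/
theorem exists_lowerSet_of_ordConnected (hF : M.IsProfileFamily m F) (hP : P ∈ F) (hQ : Q ∈ F)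
    (hg : ∀ J : Set L, J.OrdConnected → M.conn (g ⁻¹' J) ≤ m) {J : Set L} (hJ : J.OrdConnected)
    (h : Separates (g ⁻¹' J) P Q) :
    ∃ T : Set L, IsLowerSet T ∧ Distinguishes (g ⁻¹' T) P Q := by
  by_contra! hcon
  have hagree := fun T (hT : IsLowerSet T) =>
    hF.mem_iff_of_not_distinguishes hP hQ (hg T hT.ordConnected) (hcon T hT)
  have h1 : IsLowerSet {x | ∀ y ∈ J, x < y} := fun a b hba ha y hy => hba.trans_lt (ha y hy)
  have h2 : IsLowerSet {x | ∃ y ∈ J, x ≤ y} := by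
    rintro a b hba ⟨y, hy, hay⟩
    exact ⟨y, hy, hba.trans hay⟩
  -- `J` is a difference of two lower sets. If `P` and `Q` agree on both of them, then `Q` lives in
  -- `J` because `P` does.
  have heq : {x | ∃ y ∈ J, x ≤ y} ∩ {x | ∀ y ∈ J, x < y}ᶜ = J := by
    ext x
    simp only [Set.mem_inter_iff, Set.mem_ofPred, Set.mem_compl_iff, not_forall, not_lt]
    constructor
    · rintro ⟨⟨y, hy, hxy⟩, z, hz, hzx⟩
      exact hJ.out hz hy ⟨hzx, hxy⟩
    · exact fun hx => ⟨⟨x, hx, le_rfl⟩, x, hx, le_rfl⟩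
  set T₁ := {x | ∀ y ∈ J, x < y}
  set T₂ := {x | ∃ y ∈ J, x ≤ y}
  have hP1 : g ⁻¹' T₁ ∈ P := hF.mem_of_disjoint hP h.1
    (Set.disjoint_left.2 fun x hx hx' => lt_irrefl _ (hx' _ hx)) (hg _ h1.ordConnected)
  have hP2 : g ⁻¹' T₂ ∉ P := fun hmem =>
    hF.compl_notMem hP hmem (hF.compl_mem_of_subset hP h.1
      (fun x hx => ⟨_, hx, le_rfl⟩) (hg _ h2.ordConnected))
  rw [hagree T₁ h1] at hP1
  rw [hagree T₂ h2] at hP2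
  have hle : M.conn (g ⁻¹' T₂ ∩ (g ⁻¹' T₁)ᶜ) ≤ m := by
    rw [← Set.preimage_compl, ← Set.preimage_inter, heq]
    exact hg J hJ
  have := hF.compl_inter_mem hQ (hF.compl_mem hQ (hg _ h2.ordConnected) hP2)
    (by rwa [compl_compl]) hle
  rw [← Set.preimage_compl, ← Set.preimage_inter, heq] at this
  exact hF.compl_notMem hQ h.2 this

theorem exists_lowerSet_of_isCyclicInterval [CircularOrder L] (hF : M.IsProfileFamily m F)
    (hP : P ∈ F) (hQ : Q ∈ F) (hr : Linearizes r)
    (hg : ∀ J : Set L, J.OrdConnected → M.conn (g ⁻¹' J) ≤ m) {J : Set L}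
    (hJ : IsCyclicInterval J) (h : Distinguishes (g ⁻¹' J) P Q) :
    ∃ T : Set L, IsLowerSet T ∧ Distinguishes (g ⁻¹' T) P Q := by
  rcases (hr J).1 hJ with hJ | hJ
  · rcases distinguishes_iff.1 h with h | h
    · exact hF.exists_lowerSet_of_ordConnected hP hQ hg hJ h
    · obtain ⟨T, hT, hT'⟩ := hF.exists_lowerSet_of_ordConnected hQ hP hg hJ h
      exact ⟨T, hT, hT'.symm⟩
  · rcases distinguishes_iff.1 h.compl with h | h
    · exact hF.exists_lowerSet_of_ordConnected hP hQ hg hJ h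
    · obtain ⟨T, hT, hT'⟩ := hF.exists_lowerSet_of_ordConnected hQ hP hg hJ h
      exact ⟨T, hT, hT'.symm⟩

theorem _root_.LowerSet.exists_of_lt {α : Type u} [LE α] {S T : LowerSet α} (h : S < T) :
    ∃ x ∈ T, x ∉ S :=
  Set.not_subset.1 h.not_ge

theorem nonempty_of_mem (hF : M.IsProfileFamily m F) (hP : P ∈ F) {A : Set E} (hA : A ∈ P) :
    Nonempty E := by
  by_contra hE
  rw [not_nonempty_iff] at hE
  exact hF.univ_notMem P hP (Set.eq_univ_of_forall (s := A) (fun x => hE.elim x) ▸ hA)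

/-- The position of a profile in a linear order: the lower sets in which it does not live. -/
def position [LinearOrder L] (hF : M.IsProfileFamily m F) (hP : P ∈ F)
    (hg : ∀ J : Set L, J.OrdConnected → M.conn (g ⁻¹' J) ≤ m) : LowerSet (LowerSet L) where
  carrier := {T | g ⁻¹' (T : Set L) ∈ P}
  lower' := fun _ T hle h =>
    hF.mem_of_subset hP h (Set.preimage_mono hle) (hg _ T.lower.ordConnected)

/-- If order-connected sets distinguish `P` from `P'` and `Q` from `Q'`, then a single
order-connected set distinguishes both pairs. -/
theorem exists_common_separation [LinearOrder L] (hF : M.IsProfileFamily m F)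
    {P' Q' : Set (Set E)} (hP : P ∈ F) (hP' : P' ∈ F) (hQ : Q ∈ F) (hQ' : Q' ∈ F)
    (hg : ∀ J : Set L, J.OrdConnected → M.conn (g ⁻¹' J) ≤ m)
    {S T : Set L} (hS : IsLowerSet S) (hT : IsLowerSet T)
    (hPP' : Separates (g ⁻¹' S) P P') (hQQ' : Separates (g ⁻¹' T) Q Q') :
    ∃ A : Set E, Distinguishes A P P' ∧ Distinguishes A Q Q' := by
  have sep : ∀ {R : Set (Set E)} (hR : R ∈ F) (T : LowerSet L), T ∉ hF.position hR hg →
      (g ⁻¹' (T : Set L))ᶜ ∈ R := fun hR T h => hF.compl_mem hR (hg _ T.lower.ordConnected) h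
  -- When one pair lies entirely before the other, cut within each pair: the segment between the two
  -- cuts contains exactly the two inner profiles.
  have nested : ∀ {P P' Q Q' : Set (Set E)} (hP : P ∈ F) (hP' : P' ∈ F) (hQ : Q ∈ F)
      (hQ' : Q' ∈ F), hF.position hP hg < hF.position hP' hg →
      hF.position hP' hg ≤ hF.position hQ hg → hF.position hQ hg < hF.position hQ' hg →
      ∃ A : Set E, Separates A P' P ∧ Separates A Q Q' := by
    intro P P' Q Q' hP hP' hQ hQ' h1 h2 h3
    obtain ⟨T₁, h1', h1⟩ := LowerSet.exists_of_lt h1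
    obtain ⟨T₂, h3', h3⟩ := LowerSet.exists_of_lt h3
    have hsub : T₁ ≤ T₂ := by
      rcases le_total T₁ T₂ with h | h
      · exact h
      · exact absurd (h2 ((hF.position hP' hg).lower h h1')) h3
    have hle : M.conn (g ⁻¹' (T₂ : Set L) ∩ (g ⁻¹' (T₁ : Set L))ᶜ) ≤ m :=
      hg ((T₂ : Set L) ∩ (T₁ : Set L)ᶜ) (T₂.lower.ordConnected.inter T₁.lower.compl.ordConnected)
    refine ⟨g ⁻¹' (T₂ : Set L) ∩ (g ⁻¹' (T₁ : Set L))ᶜ, ⟨?_, ?_⟩, ?_, ?_⟩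
    · refine hF.compl_inter_mem hP' (sep hP' T₂ fun h => h3 (h2 h)) ?_ hle
      rw [compl_compl]
      exact h1'
    · exact hF.mem_of_disjoint hP (sep hP T₁ h1)
        (Set.disjoint_left.2 fun x hx hx' => hx'.2 hx) hle
    · refine hF.compl_inter_mem hQ (sep hQ T₂ h3) ?_ hle
      rw [compl_compl]
      exact h2 h1'
    · exact hF.mem_of_subset hQ' h3' Set.inter_subset_left hle
  have lt : ∀ {R R' : Set (Set E)} (hR : R ∈ F) (hR' : R' ∈ F) (T : LowerSet L),
      Separates (g ⁻¹' (T : Set L)) R R' → hF.position hR hg < hF.position hR' hg := by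
    intro R R' hR hR' T h
    refine lt_of_not_ge fun hle => ?_
    exact hF.compl_notMem hR (hle (show T ∈ hF.position hR' hg from h.2)) h.1
  have hPlt := lt hP hP' ⟨S, hS⟩ hPP'
  have hQlt := lt hQ hQ' ⟨T, hT⟩ hQQ'
  rcases le_or_gt (hF.position hP' hg) (hF.position hQ hg) with h1 | h1
  · obtain ⟨A, h, h'⟩ := nested hP hP' hQ hQ' hPlt h1 hQlt
    exact ⟨A, h.distinguishes.symm, h'.distinguishes⟩
  rcases le_or_gt (hF.position hQ' hg) (hF.position hP hg) with h2 | h2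
  · obtain ⟨A, h, h'⟩ := nested hQ hQ' hP hP' hQlt h2 hPlt
    exact ⟨A, h'.distinguishes, h.distinguishes.symm⟩
  -- The stretches spanned by the two pairs overlap, and a single cut inside the overlap
  -- distinguishes both.
  have hlt : max (hF.position hP hg) (hF.position hQ hg) <
      min (hF.position hP' hg) (hF.position hQ' hg) :=
    max_lt (lt_min hPlt h2) (lt_min h1 hQlt)
  obtain ⟨U, hU, hU'⟩ := LowerSet.exists_of_lt hlt
  refine ⟨g ⁻¹' (U : Set L), Separates.distinguishes ⟨?_, ?_⟩, Separates.distinguishes ⟨?_, ?_⟩⟩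
  · exact sep hP U fun h => hU' (le_max_left (hF.position hP hg) (hF.position hQ hg) h)
  · exact min_le_left (hF.position hP' hg) (hF.position hQ' hg) hU
  · exact sep hQ U fun h => hU' (le_max_right (hF.position hP hg) (hF.position hQ hg) h)
  · exact min_le_right (hF.position hP' hg) (hF.position hQ' hg) hU

end IsProfileFamily

theorem PseudoFlower.exists_common_separation {Ψ : M.PseudoFlower (m + 1)}
    {F : Set (Set (Set E))} {P P' Q Q' : Set (Set E)} (hF : M.IsProfileFamily m F)
    (hP : P ∈ F) (hP' : P' ∈ F) (hQ : Q ∈ F) (hQ' : Q' ∈ F)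
    (h : ∃ J : Set Ψ.Index, IsCyclicInterval J ∧ Distinguishes (Ψ.unionOf J) P P')
    (h' : ∃ J : Set Ψ.Index, IsCyclicInterval J ∧ Distinguishes (Ψ.unionOf J) Q Q') :
    ∃ A : Set E, Distinguishes A P P' ∧ Distinguishes A Q Q' := by
  obtain ⟨J, hJ, h⟩ := h
  obtain ⟨J', hJ', h'⟩ := h'
  obtain ⟨g, -, hg⟩ := Ψ.exists_index
  rw [hg] at h h'
  have hne : Nonempty Ψ.Index := by
    rcases h with h | h
    · exact (hF.nonempty_of_mem hP h.1).map g
    · exact (hF.nonempty_of_mem hP h.1).map g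
  obtain ⟨i₀⟩ := hne
  obtain ⟨r, hr, -⟩ := exists_inducesCircular i₀
  have hle : ∀ J : Set Ψ.Index, J.OrdConnected → M.conn (g ⁻¹' J) ≤ m := fun J hJ => by
    rw [← hg]
    exact conn_lt_succ_iff.1 (Ψ.conn_lt J ((hr.linearizes J).2 (Or.inl hJ)))
  obtain ⟨S, hS, h⟩ := hF.exists_lowerSet_of_isCyclicInterval hP hP' hr.linearizes hle hJ h
  obtain ⟨T, hT, h'⟩ := hF.exists_lowerSet_of_isCyclicInterval hQ hQ' hr.linearizes hle hJ' h'
  rcases distinguishes_iff.1 h with h | h <;> rcases distinguishes_iff.1 h' with h' | h'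
  · exact hF.exists_common_separation hP hP' hQ hQ' hle hS hT h h'
  · obtain ⟨A, h1, h2⟩ := hF.exists_common_separation hP hP' hQ' hQ hle hS hT h h'
    exact ⟨A, h1, h2.symm⟩
  · obtain ⟨A, h1, h2⟩ := hF.exists_common_separation hP' hP hQ hQ' hle hS hT h h'
    exact ⟨A, h1.symm, h2⟩
  · obtain ⟨A, h1, h2⟩ := hF.exists_common_separation hP' hP hQ' hQ hle hS hT h h'
    exact ⟨A, h1.symm, h2.symm⟩

/-! ### Joining arcs near the end of a linear order -/

/-- If the arc `t₀ᶜ ∩ t₁` is split by `Y`, and the part in `Y` can be moved past `t₁ᶜ`, then the arc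
can be joined to `t₂ᶜ`, skipping the arc between them. -/
theorem conn_skip_le {X Y t₀ t₁ t₂ : Set E} (hX : X ⊆ t₀) (h₀₁ : t₀ ⊆ t₁) (h₁₂ : t₁ ⊆ t₂)
    (cX : m ≤ M.conn X) (c₀ : M.conn t₀ᶜ = m) (c₂ : M.conn t₂ᶜ = m)
    (cZ₀ : M.conn (X ∪ (t₀ᶜ ∩ Y)) ≤ m) (cZ₂ : m ≤ M.conn (X ∪ (t₂ᶜ ∩ Y)))
    (cW₀ : m ≤ M.conn (X ∪ t₀ᶜ)) (cW₂ : M.conn (X ∪ t₂ᶜ) ≤ m)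
    (cY₂ : m ≤ M.conn (t₂ᶜ ∩ Yᶜ)) (cD : M.conn (t₁ ∩ t₀ᶜ) ≤ m)
    (cy : m ≤ M.conn (t₁ ∩ t₀ᶜ ∩ Y)) (cx : m ≤ M.conn (t₁ ∩ t₀ᶜ ∩ Yᶜ)) :
    M.conn ((t₁ ∩ t₀ᶜ) ∪ t₂ᶜ) ≤ m := by
  -- With `D` the arc `t₁ ∩ t₀ᶜ`, the aim of `hN` to `hH` is that `t₀ᶜ` stays of connectivity at
  -- most `m` after deleting either its part in `t₂ ∩ Yᶜ` (`hG`) or its part in `t₂ ∩ Y` (`hH`).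
  have hN : M.conn ((X ∪ (t₀ᶜ ∩ Y)) ∪ (X ∪ t₂ᶜ)) ≤ m := by
    refine conn_union_le cZ₀ cW₂ (cZ₂.trans_eq (congrArg M.conn ?_))
    ext e
    have := @hX e; have := @h₀₁ e; have := @h₁₂ e
    simp only [Set.mem_union, Set.mem_inter_iff, Set.mem_compl_iff]
    grind
  have hG : M.conn (t₀ᶜ ∩ (t₂ᶜ ∪ Y)) ≤ m := by
    have h := conn_inter_le hN c₀.le (cW₀.trans_eq (congrArg M.conn ?_))
    · refine (congrArg M.conn ?_).trans_le h
      ext e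
      have := @hX e; have := @h₀₁ e; have := @h₁₂ e
      simp only [Set.mem_union, Set.mem_inter_iff, Set.mem_compl_iff]
      grind
    · ext e
      have := @hX e; have := @h₀₁ e; have := @h₁₂ e
      simp only [Set.mem_union, Set.mem_inter_iff, Set.mem_compl_iff]
      grind
  have hH' : M.conn ((X ∪ (t₀ᶜ ∩ Y)) ∩ t₂) ≤ m := by
    refine conn_inter_le cZ₀ (by rw [← M.conn_compl]; exact c₂.le) ?_
    rw [← M.conn_compl]
    refine cY₂.trans_eq (congrArg M.conn ?_)
    ext e
    have := @hX e; have := @h₀₁ e; have := @h₁₂ e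
    simp only [Set.mem_union, Set.mem_inter_iff, Set.mem_compl_iff]
    grind
  have hH : M.conn (t₀ᶜ ∩ (t₂ᶜ ∪ Yᶜ)) ≤ m := by
    have h := conn_inter_le (conn_le_compl hH') c₀.le ?_
    · refine (congrArg M.conn ?_).trans_le h
      ext e
      have := @hX e; have := @h₀₁ e; have := @h₁₂ e
      simp only [Set.mem_union, Set.mem_inter_iff, Set.mem_compl_iff]
      grind
    · rw [← M.conn_compl]
      refine cX.trans_eq (congrArg M.conn ?_)
      ext e
      have := @hX e; have := @h₀₁ e; have := @h₁₂ e
      simp only [Set.mem_union, Set.mem_inter_iff, Set.mem_compl_iff]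
      grind
  -- Adding `D` to the first of these sets and intersecting with the second leaves nothing of `t₂ ∩
  -- t₁ᶜ`, but all of `t₂ᶜ` and the part of `D` outside `Y`. The hypotheses are symmetric in `Y` and
  -- `Yᶜ`, so both halves of `D` can be joined to `t₂ᶜ`.
  have part : ∀ Y : Set E, M.conn (t₀ᶜ ∩ (t₂ᶜ ∪ Y)) ≤ m → M.conn (t₀ᶜ ∩ (t₂ᶜ ∪ Yᶜ)) ≤ m →
      m ≤ M.conn (t₁ ∩ t₀ᶜ ∩ Y) → M.conn ((t₁ ∩ t₀ᶜ ∩ Yᶜ) ∪ t₂ᶜ) ≤ m := by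
    intro Y hG hH cy
    have h₁ : M.conn ((t₁ ∩ t₀ᶜ) ∪ (t₀ᶜ ∩ (t₂ᶜ ∪ Y))) ≤ m := by
      refine conn_union_le cD hG (cy.trans_eq (congrArg M.conn ?_))
      ext e
      have := @h₁₂ e
      simp only [Set.mem_union, Set.mem_inter_iff, Set.mem_compl_iff]
      grind
    have h := conn_inter_le h₁ hH (c₀.ge.trans_eq (congrArg M.conn ?_))
    · refine (congrArg M.conn ?_).trans_le h
      ext e
      have := @h₀₁ e; have := @h₁₂ e
      simp only [Set.mem_union, Set.mem_inter_iff, Set.mem_compl_iff]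
      grind
    · ext e
      simp only [Set.mem_union, Set.mem_inter_iff, Set.mem_compl_iff]
      grind
  have hx := part Y hG hH cy
  have hy := part Yᶜ hH (by rwa [compl_compl]) cx
  have h := conn_union_le hx hy (c₂.ge.trans_eq (congrArg M.conn ?_))
  · refine (congrArg M.conn ?_).trans_le h
    ext e
    simp only [Set.mem_union, Set.mem_inter_iff, Set.mem_compl_iff]
    grind
  · ext e
    simp only [Set.mem_union, Set.mem_inter_iff, Set.mem_compl_iff]
    grind

/-- If the arcs `t₀ᶜ ∩ t₁` and `t₂ᶜ` can be joined, then so can the arc `s₁ᶜ ∩ s₂` and any set `B`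
outside of it that contains `t₀ᶜ`. -/
theorem conn_opposite_le {B s₁ s₂ t₀ t₁ t₂ : Set E} (hs : s₁ ⊆ s₂) (hst : s₂ ⊆ t₀) (h₀₁ : t₀ ⊆ t₁)
    (h₁₂ : t₁ ⊆ t₂) (hB : t₀ᶜ ⊆ B) (hBs : Disjoint B (s₂ ∩ s₁ᶜ))
    (c : M.conn ((t₁ ∩ t₀ᶜ) ∪ t₂ᶜ) ≤ m) (c₂ : m ≤ M.conn t₂ᶜ)
    (cD₁ : m ≤ M.conn (t₁ ∩ t₀ᶜ)) (cD₂ : m ≤ M.conn (t₂ ∩ t₁ᶜ))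
    (cs : M.conn (t₂ ∩ s₁ᶜ) ≤ m) (cs' : M.conn (t₁ ∩ s₂ᶜ) ≤ m) (cB : M.conn B ≤ m) :
    M.conn ((s₂ ∩ s₁ᶜ) ∪ B) ≤ m := by
  have h₁ : M.conn (((t₁ ∩ t₀ᶜ) ∪ t₂ᶜ) ∪ (t₂ ∩ s₁ᶜ)ᶜ) ≤ m := by
    refine conn_union_le c (conn_le_compl cs) (c₂.trans_eq (congrArg M.conn ?_))
    ext e
    have := @hs e; have := @hst e; have := @h₀₁ e; have := @h₁₂ e
    simp only [Set.mem_union, Set.mem_inter_iff, Set.mem_compl_iff]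
    grind
  have h₂ : M.conn ((((t₁ ∩ t₀ᶜ) ∪ t₂ᶜ) ∪ (t₂ ∩ s₁ᶜ)ᶜ) ∪ (t₁ ∩ s₂ᶜ)) ≤ m := by
    refine conn_union_le h₁ cs' (cD₁.trans_eq (congrArg M.conn ?_))
    ext e
    have := @hs e; have := @hst e; have := @h₀₁ e; have := @h₁₂ e
    simp only [Set.mem_union, Set.mem_inter_iff, Set.mem_compl_iff]
    grind
  -- The complement of the set in `h₂` consists of the arc `s₂ ∩ s₁ᶜ` and the skipped arc `t₂ ∩
  -- t₁ᶜ`; the latter is exactly the overlap with `B`.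
  have h₃ := conn_union_le (conn_le_compl h₂) cB (cD₂.trans_eq (congrArg M.conn ?_))
  · refine (congrArg M.conn ?_).trans_le h₃
    ext e
    have := @hs e; have := @hst e; have := @h₀₁ e; have := @h₁₂ e; have := @hB e
    simp only [Set.mem_union, Set.mem_inter_iff, Set.mem_compl_iff] at *
    grind
  · ext e
    have := @hs e; have := @hst e; have := @h₀₁ e; have := @h₁₂ e; have := @hB e
    have hd : e ∈ B → e ∉ s₂ ∩ s₁ᶜ := fun h => Set.disjoint_left.1 hBs h
    simp only [Set.mem_union, Set.mem_inter_iff, Set.mem_compl_iff] at *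
    grind

/-- A set that is exhausted by an increasing family of sets of connectivity less than `m` has
connectivity less than `m`. -/
theorem exists_le_conn_of_chain {C : Set (Set E)} (hne : C.Nonempty) (hC : IsChain (· ⊆ ·) C)
    (h : m ≤ M.conn (⋃₀ C)) : ∃ A ∈ C, m ≤ M.conn A := by
  by_contra! hcon
  cases m with
  | zero =>
    obtain ⟨A, hA⟩ := hne
    simpa using hcon A hA
  | succ n =>
    exact (conn_lt_succ_iff.2 (M.limitClosed n C hne hC fun A hA =>
      conn_lt_succ_iff.1 (hcon A hA))).not_ge h

namespace IsProfileFamily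

variable {F : Set (Set (Set E))} {P Q q r : Set (Set E)} {L : Type u} [LinearOrder L] {g : E → L}

/-- Two profiles live at the end of a linear order without a maximum, where a set `Y` distinguishes
them and also two profiles that live elsewhere. Then any two disjoint arcs, one of which contains
a final segment, can be joined. -/
theorem conn_union_le_of_separates_at_end [NoMaxOrder L] (hF : M.IsProfileFamily m F)
    (hP : P ∈ F) (hQ : Q ∈ F) (hq : q ∈ F) (hr : r ∈ F) (hg : ∀ J : Set L, J.OrdConnected → M.conn (g ⁻¹' J) ≤ m)
    (hPsmall : ∀ T : Set L, IsLowerSet T → T ≠ Set.univ → g ⁻¹' T ∈ P)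
    (hQsmall : ∀ T : Set L, IsLowerSet T → T ≠ Set.univ → g ⁻¹' T ∈ Q)
    {X S : Set L} (hX : IsLowerSet X) (hXqr : Separates (g ⁻¹' X) q r)
    (hS : IsLowerSet S) (hSne : S ≠ Set.univ) (hSr : (g ⁻¹' S)ᶜ ∈ r)
    {Y : Set E} (hYqr : Separates Y q r) (hYQP : Separates Y Q P)
    {R J₂ J₄ : Set L} (hR : IsLowerSet R) (hRne : R ≠ Set.univ) (hJ₂ : J₂.OrdConnected)
    (hJ₂R : J₂ ⊆ R) (hJ₄ : Rᶜ ⊆ J₄) (hJJ : Disjoint J₄ J₂) (hJ₄c : M.conn (g ⁻¹' J₄) ≤ m) :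
    M.conn (g ⁻¹' (J₂ ∪ J₄)) ≤ m := by
  have hXS : X ⊆ S := by
    rcases hX.total hS with h | h
    · exact h
    · exact absurd hXqr.2 (fun hXr => hF.compl_notMem hr
        (hF.mem_of_subset hr hXr (Set.preimage_mono h) (hg S hS.ordConnected)) hSr)
  have hcX := hF.le_conn hq hr hXqr
  have hcle : ∀ {T : Set L}, IsLowerSet T → M.conn (g ⁻¹' T) ≤ m := fun hT => hg _ hT.ordConnected
  have hXP : g ⁻¹' X ∈ P := hPsmall X hX fun h => hSne (Set.univ_subset_iff.1 (h ▸ hXS))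
  -- consequences for the final segments
  have big : ∀ {T : Set L}, IsLowerSet T → T ≠ Set.univ → S ⊆ T →
      Separates (g ⁻¹' T)ᶜ Q r ∧ Separates (g ⁻¹' T)ᶜ P q := by
    intro T hT hTne hST
    refine ⟨⟨?_, ?_⟩, ?_, ?_⟩
    · rw [compl_compl]; exact hQsmall T hT hTne
    · exact hF.compl_mem_of_subset hr hSr (Set.preimage_mono hST) (hcle hT)
    · rw [compl_compl]; exact hPsmall T hT hTne
    · exact hF.compl_mem_of_subset hq hXqr.1 (Set.preimage_mono (hXS.trans hST)) (hcle hT)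
  have hXY := hF.separates_union hq hr hXqr hYqr
  have hXYc : M.conn (g ⁻¹' X ∪ Y) ≤ m := hF.conn_le hr hXY.2
  have hXYP : g ⁻¹' X ∪ Y ∈ P := hF.union_mem hP hXP hYQP.2 hXYc
  have hXYQr : Separates (g ⁻¹' X ∪ Y) Q r :=
    ⟨hF.compl_mem_of_subset hQ hYQP.1 Set.subset_union_right hXYc, hXY.2⟩
  -- `q` lives in `X`, `r` in `S` but not in `X`, and `P` and `Q` in every final segment; `Y`
  -- contains `q` and `Q` but neither `r` nor `P`. The bounds below come from choosing, for each
  -- set, two profiles that it separates.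
  have tailW : ∀ {T : Set L}, IsLowerSet T → T ≠ Set.univ → S ⊆ T →
      Separates (g ⁻¹' X ∪ (g ⁻¹' T)ᶜ) Q r := by
    intro T hT hTne hST
    obtain ⟨h, -⟩ := big hT hTne hST
    have hc : M.conn (g ⁻¹' X ∪ (g ⁻¹' T)ᶜ) ≤ m := by
      rw [← M.conn_compl, Set.compl_union, compl_compl]
      exact hg (Xᶜ ∩ T) (hX.compl.ordConnected.inter hT.ordConnected)
    exact ⟨hF.compl_mem_of_subset hQ h.1 Set.subset_union_right hc, hF.union_mem hr hXqr.2 h.2 hc⟩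
  have tailZ : ∀ {T : Set L}, IsLowerSet T → T ≠ Set.univ → S ⊆ T →
      Separates (g ⁻¹' X ∪ ((g ⁻¹' T)ᶜ ∩ Y)) Q r := by
    intro T hT hTne hST
    have := hF.separates_inter hQ hr (tailW hT hTne hST) hXYQr
    rwa [← Set.union_inter_distrib_left] at this
  have tailY : ∀ {T : Set L}, IsLowerSet T → T ≠ Set.univ → S ⊆ T →
      m ≤ M.conn ((g ⁻¹' T)ᶜ ∩ Y) := by
    intro T hT hTne hST
    have := hF.separates_inter hQ hr (big hT hTne hST).1 (tailZ hT hTne hST)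
    refine (hF.le_conn hQ hr this).trans_eq (congrArg M.conn ?_)
    have hXT : g ⁻¹' X ⊆ g ⁻¹' T := Set.preimage_mono (hXS.trans hST)
    ext e
    have := @hXT e
    simp only [Set.mem_union, Set.mem_inter_iff, Set.mem_compl_iff]
    grind
  have tailYc : ∀ {T : Set L}, IsLowerSet T → T ≠ Set.univ → S ⊆ T →
      m ≤ M.conn ((g ⁻¹' T)ᶜ ∩ Yᶜ) := by
    intro T hT hTne hST
    have hZ := hF.conn_le hr (tailZ hT hTne hST).2
    have hZ' : Separates (g ⁻¹' X ∪ ((g ⁻¹' T)ᶜ ∩ Y)) q P :=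
      ⟨hF.compl_mem_of_subset hq hXqr.1 Set.subset_union_left hZ,
        hF.mem_of_subset hP hXYP (Set.union_subset_union_right _ Set.inter_subset_right) hZ⟩
    have := hF.separates_inter hP hq (big hT hTne hST).2 hZ'.compl
    refine (hF.le_conn hP hq this).trans_eq (congrArg M.conn ?_)
    have hXT : g ⁻¹' X ⊆ g ⁻¹' T := Set.preimage_mono (hXS.trans hST)
    ext e
    have := @hXT e
    simp only [Set.mem_union, Set.mem_inter_iff, Set.mem_compl_iff]
    grind
  -- `r` lives in `A` and `P` does not, so the common truncation forbids connectivity less than `m`.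
  have between : ∀ {T : Set L} {A : Set E}, IsLowerSet T → T ≠ Set.univ → g ⁻¹' S ⊆ A →
      A ⊆ g ⁻¹' T → m ≤ M.conn A := by
    intro T A hT hTne hSA hAT
    by_contra hlt
    have hlt := not_le.1 hlt
    have hAP : A ∈ P := hF.mem_of_subset hP (hPsmall T hT hTne) hAT hlt.le
    exact hF.compl_notMem hr (hF.mem_of_mem P hP r hr A hlt hAP)
      (hF.compl_mem_of_subset hr hSr hSA hlt.le)
  -- arcs that are long enough meet a given set in a set of connectivity `m`
  have grow : ∀ {T : Set L} (B : Set E), IsLowerSet T → T ≠ Set.univ → S ⊆ T →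
      m ≤ M.conn ((g ⁻¹' T)ᶜ ∩ B) → ∃ T₁, IsLowerSet T₁ ∧ T₁ ≠ Set.univ ∧ T ⊆ T₁ ∧
        ∀ T', IsLowerSet T' → T' ≠ Set.univ → T₁ ⊆ T' →
          m ≤ M.conn (g ⁻¹' T' ∩ (g ⁻¹' T)ᶜ ∩ B) := by
    intro T B hT hTne hST hB
    obtain ⟨-, ⟨T₁, hT₁, hT₁ne, hTT₁, rfl⟩, hA⟩ := exists_le_conn_of_chain (M := M) (m := m)
      (C := {A | ∃ T₁, IsLowerSet T₁ ∧ T₁ ≠ Set.univ ∧ T ⊆ T₁ ∧ g ⁻¹' T₁ ∩ (g ⁻¹' T)ᶜ ∩ B = A})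
      ⟨_, T, hT, hTne, subset_rfl, rfl⟩
      (by
        rintro - ⟨T₁, hT₁, -, -, rfl⟩ - ⟨T₂, hT₂, -, -, rfl⟩ -
        rcases hT₁.total hT₂ with h | h
        · exact Or.inl (Set.inter_subset_inter_left _
            (Set.inter_subset_inter_left _ (Set.preimage_mono h)))
        · exact Or.inr (Set.inter_subset_inter_left _
            (Set.inter_subset_inter_left _ (Set.preimage_mono h))))
      (hB.trans_eq (congrArg M.conn (by
        ext e
        simp only [Set.mem_sUnion]
        constructor
        · rintro ⟨heT, heB⟩
          -- As there is no maximum, this lower set is proper; so proper lower sets exhaust the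
          -- ground set, and limit-closedness applies to their traces.
          refine ⟨_, ⟨T ∪ Set.Iic (g e), hT.union (isLowerSet_Iic _), ?_,
            Set.subset_union_left, rfl⟩, ⟨Or.inr le_rfl, heT⟩, heB⟩
          intro h
          obtain ⟨y, hy⟩ := exists_gt (g e)
          rcases (h ▸ Set.mem_univ y : y ∈ T ∪ Set.Iic (g e)) with h' | h'
          · exact heT (hT hy.le h')
          · exact hy.not_ge h'
        · rintro ⟨-, ⟨T₁, -, -, -, rfl⟩, ⟨-, h⟩, h'⟩
          exact ⟨h, h'⟩)))
    refine ⟨T₁, hT₁, hT₁ne, hTT₁, fun T' hT' hT'ne hT₁T' => ?_⟩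
    refine le_conn_of_le_union (B := g ⁻¹' T₁) ?_ (hcle hT₁) ?_
    · refine hA.trans_eq (congrArg M.conn ?_)
      have : g ⁻¹' T₁ ⊆ g ⁻¹' T' := Set.preimage_mono hT₁T'
      ext e
      have := @this e
      simp only [Set.mem_inter_iff, Set.mem_compl_iff]
      grind
    · exact between hT' hT'ne ((Set.preimage_mono (hST.trans hTT₁)).trans Set.subset_union_right)
        (Set.union_subset (fun e he => he.1.1) (Set.preimage_mono hT₁T'))
  have sup : ∀ {A B : Set L}, IsLowerSet A → A ≠ Set.univ → IsLowerSet B → B ≠ Set.univ →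
      IsLowerSet (A ∪ B) ∧ A ∪ B ≠ Set.univ := by
    intro A B hA hAne hB hBne
    refine ⟨hA.union hB, ?_⟩
    rcases hA.total hB with h | h
    · rwa [Set.union_eq_right.2 h]
    · rwa [Set.union_eq_left.2 h]
  -- `T₀` lies beyond `S` and `R`. Then `T₁` is chosen so large that `T₁ ∩ T₀ᶜ` and its parts inside
  -- and outside `Y` have connectivity at least `m`, and `T₂` so large that `T₂ ∩ T₁ᶜ` does.
  obtain ⟨hT₀, hT₀ne⟩ := sup hS hSne hR hRne
  have hST₀ : S ⊆ S ∪ R := Set.subset_union_left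
  have hRT₀ : R ⊆ S ∪ R := Set.subset_union_right
  generalize S ∪ R = T₀ at hT₀ hT₀ne hST₀ hRT₀
  obtain ⟨U₁, hU₁, hU₁ne, hTU₁, hgrow₁⟩ := grow Y hT₀ hT₀ne hST₀ (tailY hT₀ hT₀ne hST₀)
  obtain ⟨U₂, hU₂, hU₂ne, -, hgrow₂⟩ := grow Yᶜ hT₀ hT₀ne hST₀ (tailYc hT₀ hT₀ne hST₀)
  have conn_tail : ∀ {T : Set L}, IsLowerSet T → T ≠ Set.univ → S ⊆ T →
      m ≤ M.conn ((g ⁻¹' T)ᶜ ∩ Set.univ) := fun hT hTne hST => by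
    rw [Set.inter_univ]
    exact hF.le_conn hQ hr (big hT hTne hST).1
  obtain ⟨U₃, hU₃, hU₃ne, -, hgrow₃⟩ := grow Set.univ hT₀ hT₀ne hST₀ (conn_tail hT₀ hT₀ne hST₀)
  obtain ⟨hU₁₂, hU₁₂ne⟩ := sup hU₁ hU₁ne hU₂ hU₂ne
  obtain ⟨hT₁, hT₁ne⟩ := sup hU₁₂ hU₁₂ne hU₃ hU₃ne
  have hUT₁ : U₁ ⊆ U₁ ∪ U₂ ∪ U₃ := Set.subset_union_left.trans Set.subset_union_left
  have hUT₂ : U₂ ⊆ U₁ ∪ U₂ ∪ U₃ := Set.subset_union_right.trans Set.subset_union_left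
  have hUT₃ : U₃ ⊆ U₁ ∪ U₂ ∪ U₃ := Set.subset_union_right
  generalize U₁ ∪ U₂ ∪ U₃ = T₁ at hT₁ hT₁ne hUT₁ hUT₂ hUT₃
  have hT₀₁ := hTU₁.trans hUT₁
  have cy := hgrow₁ T₁ hT₁ hT₁ne hUT₁
  have cx := hgrow₂ T₁ hT₁ hT₁ne hUT₂
  have cD₁ := hgrow₃ T₁ hT₁ hT₁ne hUT₃
  have hST₁ := hST₀.trans hT₀₁
  obtain ⟨T₂, hT₂, hT₂ne, hT₁₂, hgrow₄⟩ := grow Set.univ hT₁ hT₁ne hST₁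
    (conn_tail hT₁ hT₁ne hST₁)
  have cD₂ := hgrow₄ T₂ hT₂ hT₂ne subset_rfl
  rw [Set.inter_univ] at cD₁ cD₂
  have hST₂ := hST₁.trans hT₁₂
  have ctail : ∀ {T : Set L}, IsLowerSet T → T ≠ Set.univ → S ⊆ T → M.conn (g ⁻¹' T)ᶜ = m :=
    fun hT hTne hST => le_antisymm (conn_le_compl (hcle hT))
      (hF.le_conn hQ hr (big hT hTne hST).1)
  have hskip : M.conn ((g ⁻¹' T₁ ∩ (g ⁻¹' T₀)ᶜ) ∪ (g ⁻¹' T₂)ᶜ) ≤ m :=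
    conn_skip_le (X := g ⁻¹' X) (Y := Y) (Set.preimage_mono (hXS.trans hST₀))
      (Set.preimage_mono hT₀₁) (Set.preimage_mono hT₁₂) hcX (ctail hT₀ hT₀ne hST₀)
      (ctail hT₂ hT₂ne hST₂) (hF.conn_le hr (tailZ hT₀ hT₀ne hST₀).2)
      (hF.le_conn hQ hr (tailZ hT₂ hT₂ne hST₂)) (hF.le_conn hQ hr (tailW hT₀ hT₀ne hST₀))
      (hF.conn_le hr (tailW hT₂ hT₂ne hST₂).2) (tailYc hT₂ hT₂ne hST₂)
      (hg (T₁ ∩ T₀ᶜ) (hT₁.ordConnected.inter hT₀.compl.ordConnected)) cy cx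
  have h₁ : IsLowerSet {x | ∀ y ∈ J₂, x < y} := fun a b hba ha y hy => hba.trans_lt (ha y hy)
  have h₂ : IsLowerSet {x | ∃ y ∈ J₂, x ≤ y} := by
    rintro a b hba ⟨y, hy, hay⟩
    exact ⟨y, hy, hba.trans hay⟩
  have heq : {x | ∃ y ∈ J₂, x ≤ y} ∩ {x | ∀ y ∈ J₂, x < y}ᶜ = J₂ := by
    ext x
    simp only [Set.mem_inter_iff, Set.mem_ofPred, Set.mem_compl_iff, not_forall, not_lt]
    constructor
    · rintro ⟨⟨y, hy, hxy⟩, z, hz, hzx⟩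
      exact hJ₂.out hz hy ⟨hzx, hxy⟩
    · exact fun hx => ⟨⟨x, hx, le_rfl⟩, x, hx, le_rfl⟩
  have hsub : {x | ∃ y ∈ J₂, x ≤ y} ⊆ T₀ := by
    rintro x ⟨y, hy, hxy⟩
    exact hT₀ hxy (hRT₀ (hJ₂R hy))
  rcases J₂.eq_empty_or_nonempty with hempty | ⟨z, hz⟩
  · rwa [hempty, Set.empty_union]
  have hs : {x | ∀ y ∈ J₂, x < y} ⊆ {x | ∃ y ∈ J₂, x ≤ y} := fun x hx => ⟨z, hz, (hx z hz).le⟩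
  have := conn_opposite_le (M := M) (m := m) (B := g ⁻¹' J₄) (s₁ := g ⁻¹' {x | ∀ y ∈ J₂, x < y})
    (s₂ := g ⁻¹' {x | ∃ y ∈ J₂, x ≤ y}) (t₀ := g ⁻¹' T₀) (t₁ := g ⁻¹' T₁) (t₂ := g ⁻¹' T₂)
    (Set.preimage_mono hs) (Set.preimage_mono hsub) (Set.preimage_mono hT₀₁)
    (Set.preimage_mono hT₁₂) (fun e he => hJ₄ fun h => he (hRT₀ h))
    (by
      rw [← Set.preimage_compl, ← Set.preimage_inter, heq]
      exact hJJ.preimage g)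
    hskip (ctail hT₂ hT₂ne hST₂).ge cD₁ cD₂
    (hg (T₂ ∩ _ᶜ) (hT₂.ordConnected.inter h₁.compl.ordConnected))
    (hg (T₁ ∩ _ᶜ) (hT₁.ordConnected.inter h₂.compl.ordConnected)) hJ₄c
  rwa [← Set.preimage_compl, ← Set.preimage_inter, heq, ← Set.preimage_union] at this

/-! ### Splitting a petal and extending the pseudoflower -/

/-- Two profiles live in the first petal of a linear order, and a set `Y` distinguishes
them and also two profiles that live elsewhere. Then the first petal can be split along `Y`. -/
theorem first_petal_split {i₀ : L} (hi₀ : ∀ i, i₀ ≤ i) (hF : M.IsProfileFamily m F)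
    (hP : P ∈ F) (hQ : Q ∈ F) (hq : q ∈ F) (hr : r ∈ F)
    (hg : ∀ J : Set L, J.OrdConnected → M.conn (g ⁻¹' J) ≤ m)
    (hPB : (g ⁻¹' {i₀})ᶜ ∈ P) (hQB : (g ⁻¹' {i₀})ᶜ ∈ Q) (hqB : g ⁻¹' {i₀} ∈ q)
    {T : Set L} (hT : IsLowerSet T) (hTqr : Separates (g ⁻¹' T) q r)
    {Y : Set E} (hYqr : Separates Y q r) (hYQP : Separates Y Q P) :
    (g ⁻¹' {i₀} ∩ Y).Nonempty ∧ (g ⁻¹' {i₀} ∩ Yᶜ).Nonempty ∧ ∀ T' : Set L, IsLowerSet T' → i₀ ∈ T' →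
      M.conn ((g ⁻¹' {i₀} ∩ Y) ∪ g ⁻¹' (T' \ {i₀})) ≤ m := by
  have hTne : i₀ ∈ T := by
    by_contra h
    have hempty : T = ∅ := Set.eq_empty_of_forall_notMem fun x hx => h (hT (hi₀ x) hx)
    have := hTqr.1
    rw [hempty, Set.preimage_empty, Set.compl_empty] at this
    exact hF.univ_notMem q hq this
  have hconn : ∀ {T : Set L}, IsLowerSet T → (T \ {i₀}).OrdConnected := fun hT =>
    ⟨fun x hx y hy z hz => ⟨hT hz.2 hy.1, fun h => hx.2 (le_antisymm (hz.1.trans (le_of_eq h))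
      (hi₀ x))⟩⟩
  have hTc := hg T hT.ordConnected
  have hXc := hg _ (hconn hT)
  have hBT : g ⁻¹' {i₀} ⊆ g ⁻¹' T := Set.preimage_mono (Set.singleton_subset_iff.2 hTne)
  have hX : Separates (g ⁻¹' (T \ {i₀})) q r := by
    refine ⟨?_, hF.mem_of_subset hr hTqr.2 (Set.preimage_mono Set.sdiff_subset) hXc⟩
    exact hF.compl_inter_mem (B := (g ⁻¹' {i₀})ᶜ) hq hTqr.1 (by rw [compl_compl]; exact hqB) hXc
  have hXB : Disjoint (g ⁻¹' {i₀}) (g ⁻¹' (T \ {i₀})) :=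
    Set.disjoint_left.2 fun e he he' => he'.2 he
  have hXY := hF.separates_union hq hr hX hYqr
  have hXYc : M.conn (g ⁻¹' (T \ {i₀}) ∪ Y) ≤ m := hF.conn_le hr hXY.2
  have hXYQ : (g ⁻¹' (T \ {i₀}) ∪ Y)ᶜ ∈ Q :=
    hF.compl_mem_of_subset hQ hYQP.1 Set.subset_union_right hXYc
  have hXYP : g ⁻¹' (T \ {i₀}) ∪ Y ∈ P :=
    hF.union_mem hP (hF.mem_of_disjoint hP hPB hXB hXc) hYQP.2 hXYc
  -- The set `Z` obtained here, the part of the petal in `Y` plus the rest of `T`, contains `Q` but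
  -- not `P`. Were one part of the petal empty, `P` and `Q` would be on the same side of `Z`.
  have hZ := hF.separates_inter hQ hr
    ⟨hF.compl_mem_of_subset hQ hQB hBT hTc, hTqr.2⟩ ⟨hXYQ, hXY.2⟩
  have heq : g ⁻¹' T ∩ (g ⁻¹' (T \ {i₀}) ∪ Y) = (g ⁻¹' {i₀} ∩ Y) ∪ g ⁻¹' (T \ {i₀}) := by
    ext e
    have := @hBT e
    simp only [Set.mem_union, Set.mem_inter_iff, Set.mem_preimage, Set.mem_sdiff,
      Set.mem_singleton_iff] at *
    grind
  have hZP : (g ⁻¹' {i₀} ∩ Y) ∪ g ⁻¹' (T \ {i₀}) ∈ P := by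
    rw [← heq]
    exact hF.mem_of_subset hP hXYP Set.inter_subset_right (hF.conn_le hr hZ.2)
  rw [heq] at hZ
  have hZc := hF.conn_le hr hZ.2
  refine ⟨?_, ?_, fun T' hT' hi => ?_⟩
  · rw [Set.nonempty_iff_ne_empty]
    intro hempty
    rw [hempty, Set.empty_union] at hZ
    exact hF.compl_notMem hQ (hF.mem_of_disjoint hQ hQB hXB hXc) hZ.1
  · rw [Set.nonempty_iff_ne_empty]
    intro hempty
    refine hF.compl_notMem hP hZP (hF.compl_mem_of_subset hP hPB (fun e he => Or.inl ⟨he, ?_⟩) hZc)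
    by_contra h
    exact (hempty ▸ (show e ∈ g ⁻¹' {i₀} ∩ Yᶜ from ⟨he, h⟩) : e ∈ (∅ : Set E))
  -- The bound passes from `T` to any other lower set `T'` containing `i₀`: take a union if `T'` is
  -- larger and an intersection if it is smaller.
  · rcases hT.total hT' with h | h
    · have := conn_union_le hZc (hg _ (hconn hT')) ((hF.le_conn hq hr hX).trans_eq
        (congrArg M.conn ?_))
      · refine (congrArg M.conn ?_).trans_le this
        ext e
        have := @h (g e)
        simp only [Set.mem_union, Set.mem_inter_iff, Set.mem_preimage, Set.mem_sdiff,
          Set.mem_singleton_iff] at *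
        grind
      · ext e
        have := @h (g e)
        simp only [Set.mem_union, Set.mem_inter_iff, Set.mem_preimage, Set.mem_sdiff,
          Set.mem_singleton_iff] at *
        grind
    · have := conn_inter_le hZc (hg _ hT'.ordConnected) ((hF.le_conn hq hr hTqr).trans_eq
        (congrArg M.conn ?_))
      · refine (congrArg M.conn ?_).trans_le this
        ext e
        have := @h (g e)
        simp only [Set.mem_union, Set.mem_inter_iff, Set.mem_preimage, Set.mem_sdiff,
          Set.mem_singleton_iff] at *
        grind
      · ext e
        have := @h (g e)
        simp only [Set.mem_union, Set.mem_inter_iff, Set.mem_preimage, Set.mem_sdiff,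
          Set.mem_singleton_iff] at *
        grind

end IsProfileFamily

namespace PseudoFlower

variable {F : Set (Set (Set E))} {P Q q r : Set (Set E)}

/-- In a maximal pseudoflower no petal can be split. -/
theorem not_isMax_of_split (Φ : M.PseudoFlower (m + 1)) {r : LinearOrder Φ.Index}
    (hr : Linearizes r) {i₀ : Φ.Index} (hi₀ : ∀ i, r.le i₀ i) {Y : Set E}
    (h₁ : (Φ.petal i₀ ∩ Y).Nonempty) (h₂ : (Φ.petal i₀ ∩ Yᶜ).Nonempty)
    (h : ∀ T : Set Φ.Index, IsLowerSet T → i₀ ∈ T →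
      M.conn ((Φ.petal i₀ ∩ Y) ∪ Φ.unionOf (T \ {i₀})) ≤ m) : ¬ IsMax Φ := by
  classical
  obtain ⟨g, hgs, hg⟩ := Φ.exists_index
  rw [petal_eq_unionOf, hg] at h₁ h₂ h
  simp only [hg] at h
  have hgc : ∀ J : Set Φ.Index, J.OrdConnected → M.conn (g ⁻¹' J) ≤ m := fun J hJ => by
    rw [← hg]
    exact conn_lt_succ_iff.1 (Φ.conn_lt J ((hr J).2 (Or.inl hJ)))
  have hlow : ∀ K : Set Φ.Index, K.OrdConnected → i₀ ∈ K → IsLowerSet K :=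
    fun K hK hi a b hba ha => hK.out hi ha ⟨hi₀ b, hba⟩
  -- The part of the petal in `Y` keeps the index `i₀`, and the rest moves to a new top element,
  -- which is next to the minimum `i₀` in the cyclic order.
  let g' : E → WithTop Φ.Index := fun e => if g e = i₀ ∧ e ∉ Y then ⊤ else (g e : WithTop Φ.Index)
  have hg'top : ∀ e, g' e = ⊤ ↔ g e = i₀ ∧ e ∉ Y := fun e => by
    by_cases he : g e = i₀ ∧ e ∉ Y <;> simp [g', he]
  have hg'coe : ∀ e (i : Φ.Index), g' e = i ↔ g e = i ∧ ¬ (g e = i₀ ∧ e ∉ Y) := fun e i => by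
    by_cases he : g e = i₀ ∧ e ∉ Y
    · simp only [g', he, not_false_eq_true, and_self, if_true, not_true, and_false, iff_false]
      exact WithTop.top_ne_coe
    · simp only [g', he, not_false_eq_true, and_true, if_false]
      exact WithTop.coe_inj
  have hsurj : Function.Surjective g' := by
    intro x
    induction x with
    | top =>
      obtain ⟨e, he, heY⟩ := h₂
      exact ⟨e, (hg'top e).2 ⟨he, heY⟩⟩
    | coe i =>
      by_cases hi : i = i₀
      · obtain ⟨e, he, heY⟩ := h₁
        exact ⟨e, (hg'coe e i).2 ⟨he.trans hi.symm, fun h => h.2 heY⟩⟩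
      · obtain ⟨e, rfl⟩ := hgs i
        exact ⟨e, (hg'coe e _).2 ⟨rfl, fun h => hi h.1⟩⟩
  have hmem : ∀ (J : Set (WithTop Φ.Index)) e, g' e ∈ J ↔
      (g e = i₀ ∧ e ∉ Y ∧ ⊤ ∈ J) ∨ (¬ (g e = i₀ ∧ e ∉ Y) ∧ (g e : WithTop Φ.Index) ∈ J) := by
    intro J e
    by_cases he : g e = i₀ ∧ e ∉ Y
    · rw [(hg'top e).2 he]; tauto
    · rw [(hg'coe e (g e)).2 ⟨rfl, he⟩]; tauto
  have hcoe : ∀ J : Set (WithTop Φ.Index), J.OrdConnected →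
      ((fun i : Φ.Index => (i : WithTop Φ.Index)) ⁻¹' J).OrdConnected := fun J hJ =>
    hJ.preimage_mono fun a b hab => WithTop.coe_le_coe.2 hab
  have split : ∀ J : Set (WithTop Φ.Index), (i₀ : WithTop Φ.Index) ∈ J → ⊤ ∉ J →
      IsLowerSet ((fun i : Φ.Index => (i : WithTop Φ.Index)) ⁻¹' J) →
      M.conn (g' ⁻¹' J) ≤ m := by
    intro J hi ht hlow
    refine (congrArg M.conn ?_).trans_le (h _ hlow hi)
    ext e
    simp only [Set.mem_preimage, hmem, Set.mem_union, Set.mem_inter_iff, Set.mem_singleton_iff,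
      Set.mem_sdiff]
    by_cases he : g e = i₀
    · simp [he, ht, hi]
    · simp [he]
  have hconn : ∀ J : Set (WithTop Φ.Index), J.OrdConnected → M.conn (g' ⁻¹' J) < (m + 1 : ℕ) := by
    intro J hJ
    rw [conn_lt_succ_iff]
    by_cases hi : (i₀ : WithTop Φ.Index) ∈ J <;> by_cases ht : (⊤ : WithTop Φ.Index) ∈ J
    · refine (congrArg M.conn ?_).trans_le (hgc Set.univ Set.ordConnected_univ)
      ext e
      simp only [Set.mem_preimage, hmem, Set.mem_univ, iff_true]
      have : (g e : WithTop Φ.Index) ∈ J :=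
        hJ.out hi ht ⟨WithTop.coe_le_coe.2 (hi₀ _), le_top⟩
      tauto
    · exact split J hi ht (hlow _ (hcoe J hJ) hi)
    · rw [← M.conn_compl]
      refine split Jᶜ hi (fun h => h ht) fun a b hba ha hb => ?_
      exact ha (hJ.out hb ht ⟨WithTop.coe_le_coe.2 hba, le_top⟩)
    · refine (congrArg M.conn ?_).trans_le (hgc _ (hcoe J hJ))
      ext e
      simp only [Set.mem_preimage, hmem]
      by_cases he : g e = i₀
      · simp [he, ht, hi]
      · simp [he]
  intro hmax
  have hle : Φ ≤ ofLinearOrder g' hsurj hconn := by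
    refine ⟨fun x : WithTop Φ.Index => x.untopD i₀, fun x e he => ?_, fun J hJ => ?_⟩
    · change g' e = x at he
      rw [petal_eq_unionOf, hg]
      change g e = _
      subst he
      by_cases he : g e = i₀ ∧ e ∉ Y
      · rw [(hg'top e).2 he]; exact he.1
      · rw [(hg'coe e (g e)).2 ⟨rfl, he⟩]; rfl
    · have key : ∀ K : Set Φ.Index, K.OrdConnected → i₀ ∉ K →
          ((fun x : WithTop Φ.Index => x.untopD i₀) ⁻¹' K).OrdConnected := by
        intro K hK hi
        refine ⟨fun x hx y hy z hz => ?_⟩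
        induction y with
        | top => exact absurd hy hi
        | coe y =>
          induction z with
          | top => exact absurd hz.2 (WithTop.not_top_le_coe y)
          | coe z =>
            induction x with
            | top => exact absurd hx hi
            | coe x => exact hK.out hx hy ⟨WithTop.coe_le_coe.1 hz.1, WithTop.coe_le_coe.1 hz.2⟩
      have key' : ∀ K : Set Φ.Index, K.OrdConnected →
          ((fun x : WithTop Φ.Index => x.untopD i₀) ⁻¹' K).OrdConnected ∨
          ((fun x : WithTop Φ.Index => x.untopD i₀) ⁻¹' K)ᶜ.OrdConnected := by
        intro K hK
        -- The default value `i₀` puts `⊤` into the preimage of a lower set containing `i₀`, so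
        -- there the complement is the order-connected one.
        by_cases hi : i₀ ∈ K
        · exact Or.inr (key Kᶜ (hlow K hK hi).compl.ordConnected fun h => h hi)
        · exact Or.inl (key K hK hi)
      let _ := LinearOrder.toCircularOrder (WithTop Φ.Index)
      have hL : InducesCircular (I := WithTop Φ.Index) inferInstance := fun _ _ _ => Iff.rfl
      refine (hL.linearizes _).2 ?_
      rcases (hr J).1 hJ with hJ | hJ
      · exact key' J hJ
      · have := key' Jᶜ hJ
        rw [Set.preimage_compl, compl_compl] at this
        exact this.symm
  obtain ⟨f, hf, -⟩ := hmax hle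
  obtain ⟨e₁, he₁, hY₁⟩ := h₁
  obtain ⟨e₂, he₂, hY₂⟩ := h₂
  have hf₀ := hf i₀
  rw [petal_eq_unionOf, hg] at hf₀
  have h1 : g' e₁ = f i₀ := hf₀ he₁
  have h2 : g' e₂ = f i₀ := hf₀ he₂
  rw [(hg'coe e₁ i₀).2 ⟨he₁, fun h => h.2 hY₁⟩] at h1
  rw [(hg'top e₂).2 ⟨he₂, hY₂⟩] at h2
  exact WithTop.coe_ne_top (h1.trans h2.symm)

end PseudoFlower

/-! ### Profiles that live at a cut -/

/-- A profile that does not live in a petal lives at the end of a suitable linear order. -/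
theorem IsProfileFamily.exists_linearizes_end {F : Set (Set (Set E))} {P : Set (Set E)}
    {I : Type u} [CircularOrder I] {g : E → I} (hF : M.IsProfileFamily m F) (hP : P ∈ F)
    (hg : ∀ J : Set I, IsCyclicInterval J → M.conn (g ⁻¹' J) ≤ m)
    (hsmall : ∀ i, g ⁻¹' {i} ∈ P) (i₀ : I) :
    ∃ r : LinearOrder I, Linearizes r ∧ (∀ x, ∃ y, r.lt x y) ∧
      ∀ T : Set I, @IsLowerSet I r.toLE T → T ≠ Set.univ → g ⁻¹' T ∈ P := by
  obtain ⟨r, hr, -⟩ := exists_inducesCircular i₀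
  have hconn : ∀ T : Set I, IsLowerSet T → M.conn (g ⁻¹' T) ≤ m := fun T hT =>
    hg T ((hr.linearizes T).2 (Or.inl hT.ordConnected))
  set U : Set I := {x | ∃ T, IsLowerSet T ∧ g ⁻¹' T ∈ P ∧ x ∈ T} with hUdef
  have hU : IsLowerSet U := fun a b hba ⟨T, hT, hTP, ha⟩ => ⟨T, hT, hTP, hT hba ha⟩
  have hTU : ∀ T, IsLowerSet T → g ⁻¹' T ∈ P → T ⊆ U := fun T hT hTP x hx => ⟨T, hT, hTP, hx⟩
  have hrot := (hr.rotate hU).linearizes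
  have rot := r.rotate_lt U
  -- If `U` is in `P`, then `P` lives immediately after `U`: moving `U` to the end puts this cut
  -- first, and reversing puts it last. Otherwise `P` lives at the end of `U`, and moving `U` to the
  -- end suffices.
  by_cases hUP : g ⁻¹' U ∈ P
  · refine ⟨(r.rotate U).reverse, hrot.reverse, fun x => ?_, fun T hT hTne => ?_⟩
    · change ∃ y, (r.rotate U).lt y x
      simp only [rot]
      by_cases hx : x ∈ U
      · have : U ≠ Set.univ := by
          rintro h
          rw [h] at hUP
          exact hF.univ_notMem P hP hUP
        obtain ⟨y, hy⟩ := (Set.ne_univ_iff_exists_notMem U).1 this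
        exact ⟨y, Or.inl ⟨hy, hx⟩⟩
      · by_contra! hcon
        refine hx (hTU (Set.Iic x) (isLowerSet_Iic x) ?_ le_rfl)
        have heq : g ⁻¹' (Set.Iic x) = g ⁻¹' U ∪ g ⁻¹' {x} := by
          rw [← Set.preimage_union]
          congr 1
          ext y
          constructor
          · intro hy
            rcases (show y ≤ x from hy).lt_or_eq with h | h
            · by_contra hyU
              have hyU' : y ∉ U := fun h => hyU (Or.inl h)
              exact h.not_ge ((hcon y).2 (iff_of_false hyU' hx))
            · exact Or.inr h
          · rintro (hy | hy)
            · exact (not_le.1 fun h => hx (hU h hy)).le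
            · exact le_of_eq hy
        rw [heq]
        exact hF.union_mem hP hUP (hsmall x) (heq ▸ hconn _ (isLowerSet_Iic x))
    · have hT' : ∀ a b, (r.rotate U).lt a b → a ∈ T → b ∈ T :=
        fun a b hab ha => hT (@le_of_lt I (r.rotate U).toPreorder _ _ hab) ha
      have hTc : M.conn (g ⁻¹' T) ≤ m :=
        hg T ((hrot.reverse T).2
          (Or.inl (@IsLowerSet.ordConnected I (r.rotate U).reverse.toPreorder T hT)))
      by_cases hTsub : T ⊆ U
      · exact hF.mem_of_subset hP hUP (Set.preimage_mono hTsub) hTc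
      obtain ⟨t, htT, htU⟩ := Set.not_subset.1 hTsub
      have hUT : U ⊆ T := fun x hx => hT' t x ((rot t x).2 (Or.inl ⟨htU, hx⟩)) htT
      obtain ⟨z, hz⟩ := (Set.ne_univ_iff_exists_notMem T).1 hTne
      have hzU : z ∉ U := fun h => hz (hUT h)
      have heq : g ⁻¹' U = g ⁻¹' T ∩ g ⁻¹' (Set.Iic z) := by
        rw [← Set.preimage_inter]
        congr 1
        ext y
        constructor
        · exact fun hy => ⟨hUT hy, (not_le.1 fun h => hzU (hU h hy)).le⟩
        · rintro ⟨hyT, hyz⟩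
          by_contra hyU
          have hlt : r.lt y z := lt_of_le_of_ne hyz fun h => hz (h ▸ hyT)
          exact hz (hT' y z ((rot y z).2 (Or.inr ⟨iff_of_false hyU hzU, hlt⟩)) hyT)
      by_contra hTP
      have hzP : g ⁻¹' (Set.Iic z) ∉ P := fun h => hzU (hTU _ (isLowerSet_Iic z) h le_rfl)
      have := hF.compl_inter_mem hP (hF.compl_mem hP hTc hTP)
        (hF.compl_mem hP (hconn _ (isLowerSet_Iic z)) hzP) (heq ▸ hconn U hU)
      rw [← heq] at this
      exact hF.compl_notMem hP hUP this
  · have hUc := hF.compl_mem hP (hconn U hU) hUP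
    refine ⟨r.rotate U, hrot, fun x => ?_, fun T hT hTne => ?_⟩
    · simp only [rot]
      by_cases hx : x ∈ U
      · by_contra! hcon
        obtain ⟨T, hT, hTP, hxT⟩ := id hx
        refine hUP (hF.mem_of_subset hP hTP (Set.preimage_mono fun y hy => ?_) (hconn U hU))
        refine hT (not_lt.1 fun h => ?_) hxT
        exact h.not_ge ((hcon y).2 (iff_of_true hx hy))
      · have : U.Nonempty := by
          rw [Set.nonempty_iff_ne_empty]
          intro h
          rw [h, Set.preimage_empty, Set.compl_empty] at hUc
          exact hF.univ_notMem P hP hUc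
        obtain ⟨y, hy⟩ := this
        exact ⟨y, Or.inl ⟨hx, hy⟩⟩
    · have hT' : ∀ a b, (r.rotate U).lt a b → b ∈ T → a ∈ T :=
        fun a b hab hb => hT (@le_of_lt I (r.rotate U).toPreorder _ _ hab) hb
      have hTc : M.conn (g ⁻¹' T) ≤ m :=
        hg T ((hrot T).2 (Or.inl (@IsLowerSet.ordConnected I (r.rotate U).toPreorder T hT)))
      by_cases hTU' : Disjoint U T
      · exact hF.mem_of_disjoint hP hUc (hTU'.preimage g) hTc
      obtain ⟨t, htU, htT⟩ := Set.not_disjoint_iff.1 hTU'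
      obtain ⟨z, hz⟩ := (Set.ne_univ_iff_exists_notMem T).1 hTne
      have hzU : z ∈ U := by
        by_contra h
        exact hz (hT' z t ((rot z t).2 (Or.inl ⟨h, htU⟩)) htT)
      obtain ⟨T₁, hT₁, hT₁P, hzT₁⟩ := id hzU
      have hlt : ∀ x ∈ T ∩ U, x < z := by
        rintro x ⟨hxT, hxU⟩
        refine lt_of_not_ge fun h => ?_
        rcases h.lt_or_eq with h | h
        · exact hz (hT' z x ((rot z x).2 (Or.inr ⟨iff_of_true hzU hxU, h⟩)) hxT)
        · exact hz (h ▸ hxT)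
      have hlow : IsLowerSet (T ∩ U) := by
        rintro a b hba ⟨haT, haU⟩
        refine ⟨?_, hU hba haU⟩
        rcases hba.lt_or_eq with h | h
        · exact hT' b a ((rot b a).2 (Or.inr ⟨iff_of_true (hU hba haU) haU, h⟩)) haT
        · exact h ▸ haT
      have hmem : g ⁻¹' (T ∩ U) ∈ P := hF.mem_of_subset hP hT₁P
        (Set.preimage_mono fun x hx => hT₁ (hlt x hx).le hzT₁) (hconn _ hlow)
      by_contra hTP
      exact hF.compl_notMem hP hmem
        (hF.compl_inter_mem hP (hF.compl_mem hP hTc hTP) hUc (hconn _ hlow))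

/-- A cyclic interval of an unbounded linear order contains a final segment or misses one. -/
theorem exists_final_segment {I : Type u} [CircularOrder I] {r : LinearOrder I} (hr : Linearizes r)
    [Nonempty I] {J : Set I} (hJ : IsCyclicInterval J) :
    ∃ x, (Set.Ici x ⊆ J ∨ Set.Ici x ⊆ Jᶜ) := by
  have key : ∀ K : Set I, K.OrdConnected → ∃ x, (Set.Ici x ⊆ K ∨ Set.Ici x ⊆ Kᶜ) := by
    intro K hK
    by_cases h : ∃ u, ∀ j ∈ K, j < u
    · obtain ⟨u, hu⟩ := h
      exact ⟨u, Or.inr fun x hx hxK => (hu x hxK).not_ge hx⟩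
    · push Not at h
      obtain ⟨t, ht, -⟩ := h (Classical.arbitrary I)
      refine ⟨t, Or.inl fun x hx => ?_⟩
      obtain ⟨j, hj, hxj⟩ := h x
      exact hK.out ht hj ⟨hx, hxj⟩
  rcases (hr J).1 hJ with h | h
  · exact key J h
  · obtain ⟨x, hx⟩ := key Jᶜ h
    rw [compl_compl] at hx
    exact ⟨x, hx.symm⟩

/-! ### Four arcs from a daisy -/

namespace PseudoFlower

theorem unionOf_ofLinearOrder {k : ℕ} {L : Type u} [LinearOrder L] {g : E → L}
    (hg : Function.Surjective g) (h : ∀ J : Set L, J.OrdConnected → M.conn (g ⁻¹' J) < k)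
    (J : Set L) : (ofLinearOrder g hg h).unionOf J = g ⁻¹' J := by
  ext x
  simp only [unionOf, ofLinearOrder, Set.mem_iUnion, Set.mem_preimage]
  exact ⟨fun ⟨i, hi, hx⟩ => (show g x = i from hx) ▸ hi, fun h => ⟨g x, h, rfl⟩⟩

theorem isCyclicInterval_ofLinearOrder {k : ℕ} {L : Type u} [LinearOrder L] {g : E → L}
    (hg : Function.Surjective g) (h : ∀ J : Set L, J.OrdConnected → M.conn (g ⁻¹' J) < k)
    (J : Set (ofLinearOrder g hg h).Index) :
    IsCyclicInterval J ↔ Set.OrdConnected (α := L) J ∨ Set.OrdConnected (α := L) Jᶜ := by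
  let _ := LinearOrder.toCircularOrder L
  have hL : InducesCircular (I := L) inferInstance := fun _ _ _ => Iff.rfl
  exact hL.linearizes J

theorem unionOf_preimage {k : ℕ} {Φ Ψ : M.PseudoFlower k} {f : Ψ.Index → Φ.Index}
    (hf : ∀ i, Ψ.petal i ⊆ Φ.petal (f i)) (J : Set Φ.Index) :
    Ψ.unionOf (f ⁻¹' J) = Φ.unionOf J := by
  obtain ⟨g, -, hg⟩ := Φ.exists_index
  obtain ⟨g', -, hg'⟩ := Ψ.exists_index
  have h : ∀ e, g e = f (g' e) := fun e => by
    have := @hf (g' e) e (by rw [petal_eq_unionOf, hg']; rfl)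
    rwa [petal_eq_unionOf, hg] at this
  rw [hg, hg']
  ext e
  simp [h]

/-- An extension of a daisy has four arcs partitioning it such that the union of opposite arcs has
large connectivity. -/
theorem IsDaisy.exists_four_arcs {Δ Φ : M.PseudoFlower (m + 1)} (hΔ : Δ.IsDaisy) (h : Δ ≤ Φ) :
    ∃ f : Φ.Index → Fin 4, (∀ c, IsCyclicInterval (f ⁻¹' {c})) ∧
      ∀ c, ¬ M.conn (Φ.unionOf (f ⁻¹' {c, c + 2})) ≤ m := by
  obtain ⟨g, hgs, hg⟩ := Δ.exists_index
  have hcard := hΔ.1.1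
  have hne : Nonempty Δ.Index := by
    by_contra hempty
    rw [not_nonempty_iff] at hempty
    rw [(ENat.card_eq_zero_iff_empty _).2 hempty] at hcard
    exact absurd hcard (by decide)
  obtain ⟨r, hr, -⟩ := exists_inducesCircular (Classical.arbitrary Δ.Index)
  obtain ⟨e⟩ : Nonempty (Fin 4 ↪o Δ.Index) := by
    have : ∃ s : Finset Δ.Index, s.card = 4 := by
      have : ∀ n ≤ 4, ∃ s : Finset Δ.Index, s.card = n := by
        intro n hn
        induction n with
        | zero => exact ⟨∅, rfl⟩
        | succ n ih =>
          obtain ⟨s, hs⟩ := ih (by omega)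
          obtain ⟨x, hx⟩ := Finset.exists_not_mem_of_card_lt_enatCard (s := s)
            (lt_of_lt_of_le (by rw [hs]; exact_mod_cast hn) hcard)
          exact ⟨insert x s, by rw [Finset.card_insert_of_notMem hx, hs]⟩
      exact this 4 le_rfl
    obtain ⟨s, hs⟩ := this
    exact ⟨s.orderEmbOfFin hs⟩
  -- Four consecutive blocks; each `e j` witnesses that block `j` is non-empty.
  let c : Δ.Index → ULift.{u} (Fin 4) := fun x =>
    if x < e 1 then ⟨0⟩ else if x < e 2 then ⟨1⟩ else if x < e 3 then ⟨2⟩ else ⟨3⟩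
  have h01 : e 0 < e 1 := e.strictMono (by decide)
  have h12 : e 1 < e 2 := e.strictMono (by decide)
  have h23 : e 2 < e 3 := e.strictMono (by decide)
  have hcs : Function.Surjective c := by
    rintro ⟨x⟩
    refine ⟨e x, ?_⟩
    fin_cases x
    · simp [c, h01]
    · simp [c, h12]
    · simp [c, h23]
    · simp [c]
  have hcm : Monotone c := by
    intro x y hxy
    simp only [c]
    split_ifs <;> first | decide | (exfalso; order)
  have hconn : ∀ J : Set (ULift.{u} (Fin 4)), J.OrdConnected →
      M.conn ((c ∘ g) ⁻¹' J) < (m + 1 : ℕ) := fun J hJ => by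
    rw [Set.preimage_comp, ← hg]
    exact Δ.conn_lt _ ((hr.linearizes _).2 (Or.inl (hJ.preimage_mono hcm)))
  have hcgs := hcs.comp hgs
  set Θ := ofLinearOrder (c ∘ g) hcgs hconn
  have hunion : ∀ J : Set Θ.Index, Θ.unionOf J = (c ∘ g) ⁻¹' J :=
    unionOf_ofLinearOrder hcgs hconn
  have hle : Θ ≤ Δ := by
    refine ⟨c, fun i x hx => ?_, fun J hJ => ?_⟩
    · rw [petal_eq_unionOf, hg] at hx
      exact congrArg c hx
    · refine (hr.linearizes _).2 ?_
      exact ((isCyclicInterval_ofLinearOrder hcgs hconn J).1 hJ).imp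
        (fun h => h.preimage_mono hcm) (fun h => h.preimage_mono hcm)
  have hval := fun J : Set (Fin 4) => hΔ.2 Θ hle (inferInstanceAs (Finite (ULift.{u} (Fin 4))))
    (ULift.down ⁻¹' J)
  have cyc : ∀ J : Set (Fin 4), IsCyclicInterval (I := Θ.Index) (ULift.down ⁻¹' J) ↔
      ∀ x ∈ J, ∀ y ∈ J, (∀ z, (x < z ∧ z < y ∨ z < y ∧ y < x ∨ y < x ∧ x < z) → z ∈ J) ∨
        ∀ z, (y < z ∧ z < x ∨ z < x ∧ x < y ∨ x < y ∧ y < z) → z ∈ J := by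
    intro J
    constructor
    · intro h x hx y hy
      exact (h ⟨x⟩ hx ⟨y⟩ hy).imp (fun h z hz => @h ⟨z⟩ hz) (fun h z hz => @h ⟨z⟩ hz)
    · rintro h ⟨x⟩ hx ⟨y⟩ hy
      exact (h x hx y hy).imp (fun h z hz => h z.down hz) (fun h z hz => h z.down hz)
  have hval : ∀ J : Set (Fin 4), (∃ x, x ∈ J) → (∃ x, x ∉ J) →
      (M.conn ((fun e => (c (g e)).down) ⁻¹' J) = m ↔
      ∀ x ∈ J, ∀ y ∈ J, (∀ z, (x < z ∧ z < y ∨ z < y ∧ y < x ∨ y < x ∧ x < z) → z ∈ J) ∨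
        ∀ z, (y < z ∧ z < x ∨ z < x ∧ x < y ∨ x < y ∧ y < z) → z ∈ J) := by
    rintro J ⟨x, hx⟩ ⟨y, hy⟩
    rw [← cyc, ← hval J ⟨⟨x⟩, hx⟩ (fun h => hy (h ▸ Set.mem_univ (⟨y⟩ : Θ.Index) :
      (⟨y⟩ : Θ.Index) ∈ ULift.down ⁻¹' J)), conn_add_one_eq_iff, hunion]
    rfl
  obtain ⟨f, hf, hf'⟩ := hle.trans h
  refine ⟨fun i => (f i).down, fun a => hf' (ULift.down ⁻¹' {a}) ((cyc {a}).2 ?_), fun a ha => ?_⟩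
  · simp only [Set.mem_singleton_iff]
    revert a
    decide
  · have h₁ : M.conn ((fun e => (c (g e)).down) ⁻¹' {a, a + 2}) ≠ m := by
      rw [Ne, hval {a, a + 2} ⟨a, by simp⟩ ⟨a + 1, by
        simp only [Set.mem_insert_iff, Set.mem_singleton_iff]; clear * -; revert a; decide⟩]
      simp only [Set.mem_insert_iff, Set.mem_singleton_iff]
      intro h
      have := h a (Or.inl rfl) (a + 2) (Or.inr rfl)
      clear * - this
      revert a
      decide
    have h₂ : M.conn ((fun e => (c (g e)).down) ⁻¹' {a, a + 1}) = m := by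
      rw [hval {a, a + 1} ⟨a, by simp⟩ ⟨a + 2, by
        simp only [Set.mem_insert_iff, Set.mem_singleton_iff]; clear * -; revert a; decide⟩]
      simp only [Set.mem_insert_iff, Set.mem_singleton_iff]
      rintro x (hx | hx) y (hy | hy) <;> rw [hx, hy] <;> clear * - <;> revert a <;> decide
    have h₃ : M.conn ((fun e => (c (g e)).down) ⁻¹' {a}) = m := by
      rw [hval {a} ⟨a, by simp⟩ ⟨a + 1, by
        simp only [Set.mem_singleton_iff]; clear * -; revert a; decide⟩]
      simp only [Set.mem_singleton_iff]
      clear * -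
      revert a
      decide
    have h₄ : M.conn ((fun e => (c (g e)).down) ⁻¹' {a, a + 1, a + 2}) = m := by
      rw [hval {a, a + 1, a + 2} ⟨a, by simp⟩ ⟨a + 3, by
        simp only [Set.mem_insert_iff, Set.mem_singleton_iff]; clear * -; revert a; decide⟩]
      simp only [Set.mem_insert_iff, Set.mem_singleton_iff]
      clear * -
      revert a
      decide
    have heq : Φ.unionOf ((fun i => (f i).down) ⁻¹' {a, a + 2}) =
        (fun e => (c (g e)).down) ⁻¹' {a, a + 2} :=
      (unionOf_preimage hf (ULift.down ⁻¹' {a, a + 2})).trans (hunion _)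
    rw [heq] at ha
    -- The daisy condition only excludes the value `m`. Uncrossing with the adjacent pair `{a, a +
    -- 1}` supplies the lower bound `m`, so the value is larger than `m`.
    refine h₁ (le_antisymm ha (le_conn_of_le_union
      (B := (fun e => (c (g e)).down) ⁻¹' {a, a + 1}) ?_ h₂.le ?_))
    · rw [← Set.preimage_inter]
      refine h₃.ge.trans_eq (congrArg (fun J => M.conn (_ ⁻¹' J)) ?_)
      ext x
      simp only [Set.mem_inter_iff, Set.mem_insert_iff, Set.mem_singleton_iff]
      clear * -
      revert a x
      decide
    · rw [← Set.preimage_union]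
      refine h₄.ge.trans_eq (congrArg (fun J => M.conn (_ ⁻¹' J)) ?_)
      ext x
      simp only [Set.mem_union, Set.mem_insert_iff, Set.mem_singleton_iff]
      tauto

end PseudoFlower

/-! ### The two cases: living in a petal and living at a cut -/

/-- To refute a symmetric configuration of four profiles, one may choose the orientation of the
sets that distinguish them. -/
theorem false_of_distinguishes {A B : Set (Set E) → Prop} {T Y : Set E} {P Q q r : Set (Set E)}
    (h : ∀ Y P Q q r, A P → A Q → B q → B r → Separates T q r → Separates Y q r →
      Separates Y Q P → False)
    (hP : A P) (hQ : A Q) (hq : B q) (hr : B r) (hT : Distinguishes T q r)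
    (hY : Distinguishes Y q r) (hY' : Distinguishes Y P Q) : False := by
  have key : ∀ q r, B q → B r → Separates T q r → Distinguishes Y q r → False := by
    intro q r hq hr hT hY
    have key' : ∀ Y, Separates Y q r → Distinguishes Y P Q → False := by
      intro Y hY hY'
      rcases distinguishes_iff.1 hY' with h' | h'
      · exact h Y Q P q r hQ hP hq hr hT hY h'
      · exact h Y P Q q r hP hQ hq hr hT hY h'
    rcases distinguishes_iff.1 hY with h' | h'
    · exact key' Y h' hY'
    · exact key' Yᶜ h'.compl hY'.compl
  rcases distinguishes_iff.1 hT with h' | h'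
  · exact key q r hq hr h' hY
  · exact key r q hr hq h' hY.symm

namespace PseudoFlower

/-- Some union of an interval of petals distinguishes `P` and `Q`. -/
def IntervalDistinguishes {k : ℕ} (Φ : M.PseudoFlower k) (P Q : Set (Set E)) : Prop :=
  ∃ J : Set Φ.Index, IsCyclicInterval J ∧ Distinguishes (Φ.unionOf J) P Q

variable {F : Set (Set (Set E))} {P Q q r : Set (Set E)} {Φ : M.PseudoFlower (m + 1)}

theorem conn_unionOf_le (Φ : M.PseudoFlower (m + 1)) {J : Set Φ.Index} (hJ : IsCyclicInterval J) :
    M.conn (Φ.unionOf J) ≤ m :=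
  conn_lt_succ_iff.1 (Φ.conn_lt J hJ)

theorem IntervalDistinguishes.symm (h : Φ.IntervalDistinguishes P Q) :
    Φ.IntervalDistinguishes Q P :=
  h.imp fun _ hJ => ⟨hJ.1, hJ.2.symm⟩

theorem mem_iff_of_not_intervalDistinguishes (hF : M.IsProfileFamily m F) (hP : P ∈ F) (hQ : Q ∈ F)
    (h : ¬ Φ.IntervalDistinguishes P Q) {J : Set Φ.Index} (hJ : IsCyclicInterval J) :
    Φ.unionOf J ∈ P ↔ Φ.unionOf J ∈ Q :=
  hF.mem_iff_of_not_distinguishes hP hQ (Φ.conn_unionOf_le hJ) fun h' => h ⟨J, hJ, h'⟩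

/-- A profile that agreed with both `q` and `r` on all intervals would make them agree with each
other. -/
theorem IntervalDistinguishes.left_or_right (hF : M.IsProfileFamily m F) (hP : P ∈ F) (hq : q ∈ F)
    (hr : r ∈ F) (h : Φ.IntervalDistinguishes q r) :
    Φ.IntervalDistinguishes P q ∨ Φ.IntervalDistinguishes P r := by
  by_contra! hcon
  obtain ⟨J, hJ, h⟩ := h
  have hq' := mem_iff_of_not_intervalDistinguishes hF hP hq hcon.1 hJ
  have hr' := mem_iff_of_not_intervalDistinguishes hF hP hr hcon.2 hJ
  rcases distinguishes_iff.1 h with h | h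
  · exact hF.compl_notMem hq (hq'.1 (hr'.2 h.2)) h.1
  · exact hF.compl_notMem hr (hr'.1 (hq'.2 h.2)) h.1

theorem isCyclicInterval_singleton {I : Type u} [CircularOrder I] (i : I) :
    IsCyclicInterval ({i} : Set I) := by
  rintro x rfl y rfl
  exact Or.inl fun z hz => absurd hz sbtw_irrefl_left_right

/-- Profiles that live in a petal of a maximal pseudoflower but are not distinguished by it. -/
theorem false_of_live_in_petal (hF : M.IsProfileFamily m F) (hmax : IsMax Φ) {i₀ : Φ.Index}
    (hP : P ∈ F) (hQ : Q ∈ F) (hq : q ∈ F) (hr : r ∈ F) (hi₀ : (Φ.petal i₀)ᶜ ∈ P)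
    (hPQ : ¬ Φ.IntervalDistinguishes P Q) (hqr : Φ.IntervalDistinguishes q r)
    (hPq : Φ.IntervalDistinguishes P q) (hPr : Φ.IntervalDistinguishes P r) {Y : Set E}
    (hY : Distinguishes Y P Q) (hY' : Distinguishes Y q r) : False := by
  obtain ⟨g, -, hg⟩ := Φ.exists_index
  have hgc : ∀ J : Set Φ.Index, IsCyclicInterval J → M.conn (g ⁻¹' J) ≤ m := fun J hJ => by
    rw [← hg]
    exact Φ.conn_unionOf_le hJ
  have hsing := isCyclicInterval_singleton i₀
  rw [petal_eq_unionOf, hg] at hi₀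
  have hQi₀ : (g ⁻¹' {i₀})ᶜ ∈ Q := by
    refine hF.compl_mem hQ (hgc _ hsing) fun h => hF.compl_notMem hP ?_ hi₀
    rw [← hg] at h ⊢
    exact (mem_iff_of_not_intervalDistinguishes hF hP hQ hPQ hsing).2 h
  -- Every interval contains or misses the petal, so all profiles that live in the petal agree on
  -- it.
  have small : ∀ s ∈ F, Φ.IntervalDistinguishes P s → g ⁻¹' {i₀} ∈ s := by
    rintro s hs ⟨J, hJ, hPs⟩
    rw [hg] at hPs
    by_contra hs'
    have hs' := hF.compl_mem hs (hgc _ hsing) hs'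
    by_cases hi : i₀ ∈ J
    · have hsub : g ⁻¹' {i₀} ⊆ g ⁻¹' J := Set.preimage_mono (Set.singleton_subset_iff.2 hi)
      have h₁ := hF.compl_mem_of_subset hP hi₀ hsub (hgc J hJ)
      have h₂ := hF.compl_mem_of_subset hs hs' hsub (hgc J hJ)
      rcases hPs with h | h
      · exact hF.compl_notMem hP h.1 h₁
      · exact hF.compl_notMem hs h.2 h₂
    · have hdis : Disjoint (g ⁻¹' {i₀}) (g ⁻¹' J) :=
        (Set.disjoint_singleton_left.2 hi).preimage g
      have h₁ := hF.mem_of_disjoint hP hi₀ hdis (hgc J hJ)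
      have h₂ := hF.mem_of_disjoint hs hs' hdis (hgc J hJ)
      rcases hPs with h | h
      · exact hF.compl_notMem hs h₂ h.2
      · exact hF.compl_notMem hP h₁ h.1
  obtain ⟨o, ho, hbot⟩ := exists_inducesCircular i₀
  have hoc : ∀ J : Set Φ.Index, J.OrdConnected → M.conn (g ⁻¹' J) ≤ m :=
    fun J hJ => hgc J ((ho.linearizes J).2 (Or.inl hJ))
  obtain ⟨J, hJ, hJqr⟩ := hqr
  rw [hg] at hJqr
  obtain ⟨T, hT, hTqr⟩ := hF.exists_lowerSet_of_isCyclicInterval hq hr ho.linearizes hoc hJ hJqr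
  refine false_of_distinguishes (A := fun s => s ∈ F ∧ (g ⁻¹' {i₀})ᶜ ∈ s)
    (B := fun s => s ∈ F ∧ g ⁻¹' {i₀} ∈ s) ?_ ⟨hP, hi₀⟩ ⟨hQ, hQi₀⟩ ⟨hq, small q hq hPq⟩
    ⟨hr, small r hr hPr⟩ hTqr hY' hY
  intro Y P Q q r hP hQ hq hr hT₁ hY₁ hY₂
  obtain ⟨h₁, h₂, h₃⟩ := hF.first_petal_split hbot hP.1 hQ.1 hq.1 hr.1 hoc hP.2 hQ.2 hq.2 hT hT₁
    hY₁ hY₂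
  refine not_isMax_of_split Φ ho.linearizes hbot (Y := Y) ?_ ?_ ?_ hmax
  · rwa [petal_eq_unionOf, hg]
  · rwa [petal_eq_unionOf, hg]
  · rw [petal_eq_unionOf, hg]
    intro T hT hi
    rw [hg]
    exact h₃ T hT hi

/-- Profiles that live at a cut of an extension of a daisy but are not distinguished by it. -/
theorem false_of_live_at_cut (hF : M.IsProfileFamily m F)
    (hdaisy : ∃ Δ : M.PseudoFlower (m + 1), Δ ≤ Φ ∧ Δ.IsDaisy)
    (hP : P ∈ F) (hQ : Q ∈ F) (hq : q ∈ F) (hr : r ∈ F) (hpetal : ∀ i, Φ.petal i ∈ P)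
    (hPQ : ¬ Φ.IntervalDistinguishes P Q) (hqr : Φ.IntervalDistinguishes q r)
    (hPq : Φ.IntervalDistinguishes P q) (hPr : Φ.IntervalDistinguishes P r) {Y : Set E}
    (hY : Distinguishes Y P Q) (hY' : Distinguishes Y q r) : False := by
  obtain ⟨g, -, hg⟩ := Φ.exists_index
  have hgc : ∀ J : Set Φ.Index, IsCyclicInterval J → M.conn (g ⁻¹' J) ≤ m := fun J hJ => by
    rw [← hg]
    exact Φ.conn_unionOf_le hJ
  have hne : Nonempty Φ.Index := by
    rcases hY with h | h
    · exact (hF.nonempty_of_mem hP h.1).map g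
    · exact (hF.nonempty_of_mem hP h.1).map g
  obtain ⟨o, ho, hnomax, hPsmall⟩ := hF.exists_linearizes_end hP hgc
    (fun i => by rw [← hg, ← petal_eq_unionOf]; exact hpetal i) (Classical.arbitrary Φ.Index)
  have : NoMaxOrder Φ.Index := ⟨hnomax⟩
  have hoc : ∀ J : Set Φ.Index, J.OrdConnected → M.conn (g ⁻¹' J) ≤ m :=
    fun J hJ => hgc J ((ho J).2 (Or.inl hJ))
  have hQsmall : ∀ T : Set Φ.Index, IsLowerSet T → T ≠ Set.univ → g ⁻¹' T ∈ Q := by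
    intro T hT hTne
    have h := hPsmall T hT hTne
    rw [← hg] at h ⊢
    exact (mem_iff_of_not_intervalDistinguishes hF hP hQ hPQ
      ((ho T).2 (Or.inl hT.ordConnected))).1 h
  have big : ∀ s ∈ F, Φ.IntervalDistinguishes P s →
      ∃ S : Set Φ.Index, IsLowerSet S ∧ S ≠ Set.univ ∧ (g ⁻¹' S)ᶜ ∈ s := by
    rintro s hs ⟨J, hJ, hPs⟩
    rw [hg] at hPs
    obtain ⟨S, hS, h⟩ := hF.exists_lowerSet_of_isCyclicInterval hP hs ho hoc hJ hPs
    rcases h with h | h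
    · refine ⟨S, hS, ?_, h.2⟩
      rintro rfl
      exact hF.univ_notMem P hP h.1
    · by_cases hSne : S = Set.univ
      · rw [hSne] at h
        exact absurd h.2 (hF.univ_notMem s hs)
      · exact absurd h.1 (hF.compl_notMem hP (hPsmall S hS hSne))
  -- a final segment is contained in one of four arcs
  obtain ⟨Δ, hΔ, hΔd⟩ := hdaisy
  obtain ⟨f, hf, hf'⟩ := hΔd.exists_four_arcs hΔ
  obtain ⟨c, x, hx⟩ : ∃ c x, Set.Ici x ⊆ f ⁻¹' {c} := by
    by_contra! hcon
    choose u hu using fun c => exists_final_segment ho (hf c)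
    -- If each of the four arcs missed a final segment, the largest of the four starting points
    -- would lie in no arc.
    obtain ⟨c₀, hc₀⟩ := Finite.exists_max u
    refine ((hu (f (u c₀))).resolve_left (hcon _ _)) (hc₀ (f (u c₀))) rfl
  have hlow : IsLowerSet (Set.Iio x) := isLowerSet_Iio x
  have hlowne : Set.Iio x ≠ Set.univ := fun h => lt_irrefl x (h ▸ Set.mem_univ x : x ∈ Set.Iio x)
  have hcompl : (Set.Iio x)ᶜ ⊆ f ⁻¹' {c} := by rwa [Set.compl_Iio]
  have hcne : c ≠ c + 2 := by
    clear * -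
    revert c
    decide
  have hdisj : Disjoint (f ⁻¹' {c}) (f ⁻¹' {c + 2}) :=
    (Set.disjoint_singleton.2 hcne).preimage f
  have hsub : f ⁻¹' {c + 2} ⊆ Set.Iio x := by
    intro y hy
    by_contra h
    exact Set.disjoint_left.1 hdisj (hcompl h) hy
  have hord : (f ⁻¹' {c + 2}).OrdConnected := by
    rcases (ho _).1 (hf (c + 2)) with h | h
    · exact h
    · refine ⟨fun a ha b hb z hz => ?_⟩
      by_contra hzc
      exact h.out hzc (fun h' => Set.disjoint_left.1 hdisj (hx (Set.mem_Ici.2 le_rfl)) h')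
        ⟨hz.2, (hsub hb).le⟩ hb
  refine hf' c ?_
  obtain ⟨J, hJ, hJqr⟩ := hqr
  rw [hg] at hJqr
  obtain ⟨T, hT, hTqr⟩ := hF.exists_lowerSet_of_isCyclicInterval hq hr ho hoc hJ hJqr
  by_contra hcon
  refine false_of_distinguishes
    (A := fun s => s ∈ F ∧ ∀ T : Set Φ.Index, IsLowerSet T → T ≠ Set.univ → g ⁻¹' T ∈ s)
    (B := fun s => s ∈ F ∧ ∃ S : Set Φ.Index, IsLowerSet S ∧ S ≠ Set.univ ∧ (g ⁻¹' S)ᶜ ∈ s)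
    ?_ ⟨hP, hPsmall⟩ ⟨hQ, hQsmall⟩ ⟨hq, big q hq hPq⟩ ⟨hr, big r hr hPr⟩ hTqr hY' hY
  rintro Y P Q q r ⟨hP, hPsmall⟩ ⟨hQ, hQsmall⟩ ⟨hq, -⟩ ⟨hr, S, hS, hSne, hSr⟩ hT₁ hY₁ hY₂
  have := hF.conn_union_le_of_separates_at_end hP hQ hq hr hoc hPsmall hQsmall hT hT₁ hS hSne hSr
    hY₁ hY₂ hlow hlowne hord hsub hcompl hdisj (hgc _ (hf c))
  refine hcon ?_
  rw [hg]
  refine (congrArg (fun J => M.conn (g ⁻¹' J)) ?_).trans_le this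
  ext y
  simp only [Set.mem_preimage, Set.mem_insert_iff, Set.mem_union, Set.mem_singleton_iff]
  exact Or.comm

/-- The definition of a profile does not by itself exclude the whole ground set. A displayed set is
non-empty and proper, and a profile must orient it; together with the ground set, either orientation
violates consistency. -/
theorem Displays.isProfileFamily {Pset : Set (Set (Set E))} {P₀ : Set (Set E)}
    (hprofile : ∀ P ∈ Pset, M.IsProfile (m + 1) P)
    (htruncation : ∀ P ∈ Pset, M.truncation m P = P₀) {A : Set E} (hA : Φ.Displays A) :
    M.IsProfileFamily m Pset := by
  refine ⟨hprofile, fun P hP huniv => ?_, fun P hP Q hQ A hA hAP => ?_⟩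
  · obtain ⟨J, hJ, ⟨i, hi⟩, hne, rfl⟩ := hA
    obtain ⟨j, hj⟩ := (Set.ne_univ_iff_exists_notMem J).1 hne
    obtain ⟨g, hgs, hg⟩ := Φ.exists_index
    obtain ⟨a, rfl⟩ := hgs i
    obtain ⟨b, rfl⟩ := hgs j
    have key : ∀ B : Set E, B ∈ P → (∃ a, a ∈ B) → (∃ b, b ∉ B) → False := by
      rintro B hB ⟨a, ha⟩ ⟨b, hb⟩
      have h := (hprofile P hP).consistent Bᶜ Set.univ (by rwa [compl_compl]) huniv
        ((Set.ssubset_univ_iff).2 fun h => (h ▸ Set.mem_univ a : a ∈ Bᶜ) ha)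
      rw [compl_compl] at h
      exact hb (h ▸ Set.mem_univ b)
    obtain ⟨B, ⟨hB, rfl | rfl⟩, -⟩ := (hprofile P hP).orientation (Φ.unionOf J) (Φ.conn_lt J hJ)
    · exact key _ hB ⟨a, by rw [hg]; exact hi⟩ ⟨b, by rw [hg]; exact hj⟩
    · exact key _ hB ⟨b, by rw [hg]; exact hj⟩ ⟨a, by rw [hg]; exact fun h => h hi⟩
  · have h : A ∈ M.truncation m P := ⟨hAP, hA⟩
    rw [htruncation P hP, ← htruncation Q hQ] at h
    exact h.1

theorem DisplaysDistinction.intervalDistinguishes (h : Φ.DisplaysDistinction P Q) :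
    Φ.IntervalDistinguishes P Q := by
  obtain ⟨A, ⟨J, hJ, -, -, rfl⟩, hA⟩ := h
  exact ⟨J, hJ, hA⟩

end PseudoFlower

end ConnectivitySystem

theorem mainTheorem5 {E : Type*} (M : ConnectivitySystem E) (k : ℕ) (hk : 1 ≤ k)
    (Pset : Set (Set (Set E))) (P₀ : Set (Set E))
    (hprofile : ∀ P ∈ Pset, M.IsProfile k P)
    (htruncation : ∀ P ∈ Pset, M.truncation (k - 1) P = P₀)
    (Φ : M.PseudoFlower k)
    (hmax : IsMax Φ)
    (hdaisy : ∃ Δ : M.PseudoFlower k, Δ ≤ Φ ∧ Δ.IsDaisy)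
    (hthree : Φ.DistinguishesThree Pset) :
    Φ.IsPrecMaximal Pset := by
  obtain ⟨m, rfl⟩ : ∃ m, k = m + 1 := ⟨k - 1, by omega⟩
  rw [Nat.add_sub_cancel] at htruncation
  obtain ⟨p₁, hp₁, p₂, hp₂, p₃, hp₃, h₁₂, h₁₃, h₂₃⟩ := hthree
  have hF : M.IsProfileFamily m Pset := by
    obtain ⟨A, hA, -⟩ := h₁₂
    exact hA.isProfileFamily hprofile htruncation
  replace h₁₂ := h₁₂.intervalDistinguishes
  replace h₁₃ := h₁₃.intervalDistinguishes
  replace h₂₃ := h₂₃.intervalDistinguishes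
  intro Ψ hΦΨ P hP Q hQ hΨ
  by_contra hPQ
  have main : ∀ q ∈ Pset, ∀ r ∈ Pset, Φ.IntervalDistinguishes q r →
      Φ.IntervalDistinguishes P q → Φ.IntervalDistinguishes P r → False := by
    intro q hq r hr hqr hPq hPr
    obtain ⟨Y, hY, hY'⟩ := Ψ.exists_common_separation hF hP hQ hq hr hΨ (hΦΨ q hq r hr hqr)
    by_cases hpetal : ∀ i, Φ.petal i ∈ P
    · exact ConnectivitySystem.PseudoFlower.false_of_live_at_cut hF hdaisy hP hQ hq hr hpetal hPQ
        hqr hPq hPr hY hY'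
    · obtain ⟨i₀, hi₀⟩ := not_forall.1 hpetal
      refine ConnectivitySystem.PseudoFlower.false_of_live_in_petal hF hmax hP hQ hq hr
        (hF.compl_mem hP ?_ hi₀) hPQ hqr hPq hPr hY hY'
      rw [ConnectivitySystem.PseudoFlower.petal_eq_unionOf]
      exact Φ.conn_unionOf_le (ConnectivitySystem.PseudoFlower.isCyclicInterval_singleton i₀)
  -- `P` can agree with at most one of the three profiles on the intervals of `Φ`; the other two
  -- serve as `q` and `r`.
  by_cases h₁ : Φ.IntervalDistinguishes P p₁
  · rcases h₂₃.left_or_right hF hP hp₂ hp₃ with h | h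
    · exact main p₁ hp₁ p₂ hp₂ h₁₂ h₁ h
    · exact main p₁ hp₁ p₃ hp₃ h₁₃ h₁ h
  · exact main p₂ hp₂ p₃ hp₃ h₂₃ ((h₁₂.left_or_right hF hP hp₁ hp₂).resolve_left h₁)
      ((h₁₃.left_or_right hF hP hp₁ hp₃).resolve_left h₁)
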